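/- A *spiral* is a planar curve $Z:[0,S]\to\mathbb C$ ($S>0$) parametrized by arc length, $Z'(s)=e^{i\tau(s)}$, with a continuous tangent angle $\tau$ and $\tau(s)=\tau(0)+\int_0^s k$, whose curvature $k$ is (weakly) monotonic, non-constant, piecewise continuous on $(0,S)$ and integrable, and which does not contain the full circumference of any circle. Put $k_1=k(0+)$, $k_2=k(S-)$; infinite values of $k_1,k_2$ are admitted. The spiral is *normalized* if $Z(0)=-c$, $Z(S)=c$ for some $c>0$. *Reference point.* If $k$ changes sign ($k_1<0<k_2$ or $k_2<0<k_1$), let $s_0\in(0,S)$ be an inflection point, i.e. a point with $k$ of the (weak) sign of $k_1$ on $(0,s_0)$ and of the (weak) sign of $k_2$ on $(s_0,S)$. Otherwise let $s_0$ be the endpoint with the smaller absolute value of curvature: $s_0=0$ if $0\le k_1<k_2$ or $k_2<k_1\le 0$, and $s_0=S$ if $k_1<k_2\le 0$ or $0\le k_2<k_1$. It splits the spiral into the left branch $[0,s_0]$ and the right branch $[s_0,S]$. *Counters.* $M_1$ (resp. $M_2$) is the number of $s\in(0,S)$ on the left (resp. right) branch at which the tangent is opposite to the chord, $\cos\tau(s)=-1$.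 $N_1$ (resp. $N_2$) is the number of $s\in(0,S)$ at which the curve meets the left complement $(-\infty,-c)$ (resp. the right complement $(c,\infty)$) of its chord on the real axis. *Cumulative boundary angles.* Let $\widetilde\mu(u,v)$, $0\le u\le v\le S$, be the continuous function with $\widetilde\mu(u,u)=\tau(u)$ which for $u<v$ is a determination of $\arg[Z(v)-Z(u)]$, and put $\widetilde\alpha=\tau(0)-\widetilde\mu(0,S)$, $\widetilde\beta=\tau(S)-\widetilde\mu(0,S)$. **Theorem.** For every normalized spiral and every reference point $s_0$ as above, the four counters are finite, $M_1=N_1$ and $M_2=N_2$. The angles $\widetilde\alpha,\widetilde\beta$ exist, and, with $\alpha\equiv\tau(0)$ and $\beta\equiv\tau(S)$ modulo $2\pi$, $$ \begin{array}{llll} k_1<k_2:& \widetilde\alpha=\alpha+2\pi N_1,& \widetilde\beta=\beta+2\pi N_2 & \text{with }\alpha,\beta\in(-\pi,\pi],\\ k_1>k_2:& \widetilde\alpha=\alpha-2\pi N_1,& \widetilde\beta=\beta-2\pi N_2 & \text{with }\alpha,\beta\in[-\pi,\pi). \end{array} $$ In more detail, for increasing curvature: $$ \begin{array}{llll} 0\le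 k_1<k_2:& -\pi<\alpha<0,\ -\pi<\beta\le\pi,& \widetilde\alpha=\alpha\ (N_1=0),& \widetilde\beta=\beta+2\pi N_2;\\ k_1<0<k_2:& -\pi<\alpha\le\pi,\ -\pi<\beta\le\pi,& \widetilde\alpha=\alpha+2\pi N_1,& \widetilde\beta=\beta+2\pi N_2;\\ k_1<k_2\le 0:& -\pi<\alpha\le\pi,\ -\pi<\beta<0,& \widetilde\alpha=\alpha+2\pi N_1,& \widetilde\beta=\beta\ (N_2=0). \end{array} $$ -/

import Mathlib

open Set Filter Topology

/-- A spiral: a planar curve `Z`, parametrized by arc length `s ∈ [0, S]`, with tangent angle `τ`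
(so `Z' = exp (i τ)`) and signed curvature `k` (so `τ` is a primitive of `k`). The curvature is
monotonic, not constant, piecewise continuous (finitely many discontinuities; the one-sided limits
exist by monotonicity), and the curve contains no full circumference.

The curvature is finite in the open interval `(0, S)`; its end values `k₁ = k(0+)`, `k₂ = k(S-)`
are extended reals, since infinite curvature at an endpoint is admitted (the values of the function
`k` at `0`, at `S` and outside `[0, S]` are irrelevant). -/
structure Spiral where
  /-- the length -/
  S : ℝ
  /-- the curve -/
  Z : ℝ → ℂ
  /-- the tangent angle (a continuous determination) -/
  τ : ℝ → ℝ
  /-- the curvature -/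
  k : ℝ → ℝ
  /-- the curvature at the start point -/
  k₁ : EReal
  /-- the curvature at the end point -/
  k₂ : EReal
  S_pos : 0 < S
  hasDeriv_Z : ∀ s ∈ Icc 0 S,
    HasDerivWithinAt Z (Complex.exp ((τ s : ℂ) * Complex.I)) (Icc 0 S) s
  integrable_k : IntervalIntegrable k MeasureTheory.volume 0 S
  τ_eq : ∀ s ∈ Icc 0 S, τ s = τ 0 + ∫ σ in (0 : ℝ)..s, k σ
  monotonic_k : MonotoneOn k (Ioo 0 S) ∨ AntitoneOn k (Ioo 0 S)
  piecewise_continuous_k : ∃ F : Set ℝ, F.Finite ∧ ∀ s ∈ Ioo 0 S \ F, ContinuousAt k s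
  tendsto_k₁ : Tendsto (fun s => (k s : EReal)) (𝓝[>] 0) (𝓝 k₁)
  tendsto_k₂ : Tendsto (fun s => (k s : EReal)) (𝓝[<] S) (𝓝 k₂)
  /-- The curvature is not constant. -/
  k₁_ne_k₂ : k₁ ≠ k₂
  no_circumference : ∀ (p : ℂ) (r : ℝ), 0 < r → ¬ Metric.sphere p r ⊆ Z '' Icc 0 S

namespace Spiral

/-- The spiral is normalized, with chord of length `2 c`: it goes from `-c` to `c`. -/
def IsNormalized (γ : Spiral) (c : ℝ) : Prop :=
  0 < c ∧ γ.Z 0 = -(c : ℂ) ∧ γ.Z γ.S = (c : ℂ)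

/-- `s₀` is an inflection point: an inner point at which the curvature changes sign. It is
a zero of the curvature (possibly one of a whole segment of zeros) or a jump of the curvature
across zero. -/
def IsInflectionPoint (γ : Spiral) (s₀ : ℝ) : Prop :=
  s₀ ∈ Ioo 0 γ.S ∧
    ((γ.k₁ < 0 ∧ 0 < γ.k₂ ∧ (∀ s ∈ Ioo 0 s₀, γ.k s ≤ 0) ∧ ∀ s ∈ Ioo s₀ γ.S, 0 ≤ γ.k s) ∨
     (0 < γ.k₁ ∧ γ.k₂ < 0 ∧ (∀ s ∈ Ioo 0 s₀, 0 ≤ γ.k s) ∧ ∀ s ∈ Ioo s₀ γ.S, γ.k s ≤ 0))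

/-- `s₀` is a reference point, where the absolute value of the curvature is minimal: an inflection
point if the curvature changes sign; otherwise the endpoint with the smaller absolute curvature. -/
def IsReferencePoint (γ : Spiral) (s₀ : ℝ) : Prop :=
  γ.IsInflectionPoint s₀ ∨
    (((0 ≤ γ.k₁ ∧ γ.k₁ < γ.k₂) ∨ (γ.k₂ < γ.k₁ ∧ γ.k₁ ≤ 0)) ∧ s₀ = 0) ∨
    (((γ.k₁ < γ.k₂ ∧ γ.k₂ ≤ 0) ∨ (0 ≤ γ.k₂ ∧ γ.k₂ < γ.k₁)) ∧ s₀ = γ.S)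

/-- Auxiliary: a monotone function that is negative near `0` and positive near `S` changes sign. -/
theorem exists_sign_change {f : ℝ → ℝ} {S a b : ℝ} (hf : MonotoneOn f (Ioo 0 S))
    (ha : a ∈ Ioo 0 S) (hb : b ∈ Ioo 0 S) (hfa : f a < 0) (hfb : 0 < f b) :
    ∃ s₀ ∈ Ioo 0 S, (∀ s ∈ Ioo 0 s₀, f s ≤ 0) ∧ ∀ s ∈ Ioo s₀ S, 0 ≤ f s := by
  set E : Set ℝ := {s | s ∈ Ioo 0 S ∧ f s < 0} with hE
  have haE : a ∈ E := ⟨ha, hfa⟩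
  have hub : ∀ s ∈ E, s ≤ b := by
    intro s hs
    by_contra h
    have := hf hb hs.1 (le_of_lt (not_le.1 h))
    have := hs.2
    linarith
  have hbdd : BddAbove E := ⟨b, hub⟩
  have h1 : a ≤ sSup E := le_csSup hbdd haE
  have h2 : sSup E ≤ b := csSup_le ⟨a, haE⟩ hub
  have hS : sSup E < S := lt_of_le_of_lt h2 hb.2
  have h0 : 0 < sSup E := lt_of_lt_of_le ha.1 h1
  refine ⟨sSup E, ⟨h0, hS⟩, ?_, ?_⟩
  · intro s hs
    obtain ⟨t, ht, hst⟩ := exists_lt_of_lt_csSup ⟨a, haE⟩ hs.2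
    have := hf ⟨hs.1, hst.trans ht.1.2⟩ ht.1 hst.le
    have := ht.2
    linarith
  · intro s hs
    by_contra h
    have : s ≤ sSup E := le_csSup hbdd ⟨⟨h0.trans hs.1, hs.2⟩, not_le.1 h⟩
    exact absurd hs.1 (not_lt.2 this)

/-- Every spiral has a reference point. -/
theorem exists_isReferencePoint (γ : Spiral) : ∃ s₀, γ.IsReferencePoint s₀ := by
  have hS := γ.S_pos
  have n0 : ∀ᶠ s in 𝓝[>] (0 : ℝ), s ∈ Ioo 0 (γ.S / 2) :=
    Ioo_mem_nhdsGT (by linarith)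
  have nS : ∀ᶠ s in 𝓝[<] γ.S, s ∈ Ioo (γ.S / 2) γ.S :=
    Ioo_mem_nhdsLT (by linarith)
  rcases lt_or_gt_of_ne γ.k₁_ne_k₂ with h | h
  · by_cases h1 : 0 ≤ γ.k₁
    · exact ⟨0, Or.inr (Or.inl ⟨Or.inl ⟨h1, h⟩, rfl⟩)⟩
    by_cases h2 : γ.k₂ ≤ 0
    · exact ⟨γ.S, Or.inr (Or.inr ⟨Or.inl ⟨h, h2⟩, rfl⟩)⟩
    rw [not_le] at h1 h2
    obtain ⟨a, ha, ha'⟩ := (n0.and (γ.tendsto_k₁.eventually_lt_const h1)).exists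
    obtain ⟨b, hb, hb'⟩ := (nS.and (γ.tendsto_k₂.eventually_const_lt h2)).exists
    have ha' : γ.k a < 0 := by exact_mod_cast ha'
    have hb' : 0 < γ.k b := by exact_mod_cast hb'
    have haI : a ∈ Ioo 0 γ.S := ⟨ha.1, by linarith [ha.2]⟩
    have hbI : b ∈ Ioo 0 γ.S := ⟨by linarith [hb.1], hb.2⟩
    have hm : MonotoneOn γ.k (Ioo 0 γ.S) := by
      rcases γ.monotonic_k with hm | hm
      · exact hm
      · have := hm haI hbI (by linarith [ha.2, hb.1])
        linarith
    obtain ⟨s₀, hs, hl, hr⟩ := exists_sign_change hm haI hbI ha' hb'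
    exact ⟨s₀, Or.inl ⟨hs, Or.inl ⟨h1, h2, hl, hr⟩⟩⟩
  · by_cases h1 : γ.k₁ ≤ 0
    · exact ⟨0, Or.inr (Or.inl ⟨Or.inr ⟨h, h1⟩, rfl⟩)⟩
    by_cases h2 : 0 ≤ γ.k₂
    · exact ⟨γ.S, Or.inr (Or.inr ⟨Or.inr ⟨h2, h⟩, rfl⟩)⟩
    rw [not_le] at h1 h2
    obtain ⟨a, ha, ha'⟩ := (n0.and (γ.tendsto_k₁.eventually_const_lt h1)).exists
    obtain ⟨b, hb, hb'⟩ := (nS.and (γ.tendsto_k₂.eventually_lt_const h2)).exists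
    have ha' : 0 < γ.k a := by exact_mod_cast ha'
    have hb' : γ.k b < 0 := by exact_mod_cast hb'
    have haI : a ∈ Ioo 0 γ.S := ⟨ha.1, by linarith [ha.2]⟩
    have hbI : b ∈ Ioo 0 γ.S := ⟨by linarith [hb.1], hb.2⟩
    have hm : AntitoneOn γ.k (Ioo 0 γ.S) := by
      rcases γ.monotonic_k with hm | hm
      · have := hm haI hbI (by linarith [ha.2, hb.1])
        linarith
      · exact hm
    obtain ⟨s₀, hs, hl, hr⟩ := exists_sign_change (f := fun s => -γ.k s) hm.neg haI hbI
      (by simpa using ha') (by simpa using hb')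
    exact ⟨s₀, Or.inl ⟨hs, Or.inr ⟨h1, h2, fun s h => by simpa using hl s h,
      fun s h => by simpa using hr s h⟩⟩⟩

/-- The inner points of the left branch `[0, s₀]` where the tangent has the direction opposite to
that of the chord of the normalized spiral. -/
def leftOppositeTangents (γ : Spiral) (s₀ : ℝ) : Set ℝ :=
  {s | s ∈ Ioo 0 γ.S ∧ s ≤ s₀ ∧ Real.cos (γ.τ s) = -1}

/-- The same for the right branch `[s₀, S]`. -/
def rightOppositeTangents (γ : Spiral) (s₀ : ℝ) : Set ℝ :=
  {s | s ∈ Ioo 0 γ.S ∧ s₀ ≤ s ∧ Real.cos (γ.τ s) = -1}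

/-- The inner points where the normalized spiral meets the left complement of its chord, that is
the open ray `(-∞, -c)` of the real axis. -/
def leftComplementPoints (γ : Spiral) (c : ℝ) : Set ℝ :=
  {s | s ∈ Ioo 0 γ.S ∧ (γ.Z s).im = 0 ∧ (γ.Z s).re < -c}

/-- The inner points where the normalized spiral meets the right complement of its chord, that is
the open ray `(c, ∞)` of the real axis. -/
def rightComplementPoints (γ : Spiral) (c : ℝ) : Set ℝ :=
  {s | s ∈ Ioo 0 γ.S ∧ (γ.Z s).im = 0 ∧ c < (γ.Z s).re}

/-- The closed triangle of all pairs `(u, v)` with `0 ≤ u ≤ v ≤ S`, i.e. of all subarcs. -/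
def subarcs (γ : Spiral) : Set (ℝ × ℝ) :=
  {p | 0 ≤ p.1 ∧ p.1 ≤ p.2 ∧ p.2 ≤ γ.S}

/-- `μ u v` is the cumulative direction of the chord from `Z u` to `Z v`: a determination of
`arg (Z v - Z u)`, continuous in all subarcs, degenerate ones included, on which it is the direction
of the tangent. -/
def IsCumulativeChordAngle (γ : Spiral) (μ : ℝ → ℝ → ℝ) : Prop :=
  ContinuousOn (fun p : ℝ × ℝ => μ p.1 p.2) γ.subarcs ∧
    (∀ u ∈ Icc 0 γ.S, μ u u = γ.τ u) ∧
    ∀ u v, 0 ≤ u → u < v → v ≤ γ.S → γ.Z u ≠ γ.Z v ∧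
      γ.Z v - γ.Z u = (‖γ.Z v - γ.Z u‖ : ℂ) * Complex.exp ((μ u v : ℂ) * Complex.I)

/-- The cumulative boundary angle at the start of the whole arc, for the cumulative chord direction
`μ`; it vanishes on degenerate subarcs. -/
def cumulativeAlpha (γ : Spiral) (μ : ℝ → ℝ → ℝ) : ℝ :=
  γ.τ 0 - μ 0 γ.S

/-- The cumulative boundary angle at the end of the whole arc. -/
def cumulativeBeta (γ : Spiral) (μ : ℝ → ℝ → ℝ) : ℝ :=
  γ.τ γ.S - μ 0 γ.S

end Spiral

/-! By reversal and reflection it suffices to treat the left counters for increasing curvature. The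
geometric input is Kneser's nesting of osculating circles: for a fixed point `z`, the position
`contact (k s) s z` of `z` relative to the osculating circle at `s` is monotone in `s`
(`monotoneOn_contact`). Hence the later part of the curve lies on the left of each osculating circle
and the earlier part on the right, and a second contact is possible only along an arc of that
circle. As full circles are excluded, the curve is simple (`Z_ne`), so the chord direction lifts to
a continuous angle `μ` on the triangle of subarcs.

The endpoints `-c` and `c` are thus separated by the tangent line at the reference point, which
makes that tangent point downwards, and by the osculating circle at each point of the left
complement, which makes the curve cross it upwards.

Two angles are then followed: `τ` on `[0, s₀]` and `v ↦ μ 0 v` on `[0, S]`. Both start at `τ 0`; the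
second ends at `2πj`, the first within `π` of it (`chord_sub_τ_mem`). Both pass the direction
opposite to the chord only clockwise, so the number of passages is read off from the boundary values
(`finite_and_ncard_of_forall_crossing`). The passages are counted by `M₁` and `N₁` respectively,
whence `M₁ = N₁`, and the same number is the number of turns by which the cumulative angle exceeds
`α`. -/

theorem monotoneOn_of_sub_le_mul_sub {G h : ℝ → ℝ} {I : Set ℝ} [I.OrdConnected] {C : ℝ}
    (H : ∀ a ∈ I, ∀ b ∈ I, a ≤ b → G a - G b ≤ C * (h b - h a) * (b - a)) : MonotoneOn G I := by
  intro a ha b hb hab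
  -- On a subdivision into `n` equal parts the increments of `h` telescope, while the factor `b - a`
  -- shrinks to `(b - a) / n`; the bound tends to zero.
  have key : ∀ n : ℕ, 0 < n → G a - G b ≤ (C * (h b - h a) * (b - a)) * (1 / (n : ℝ)) := by
    intro n hn
    have hn' : (0 : ℝ) < n := by exact_mod_cast hn
    set x : ℕ → ℝ := fun i => a + i * ((b - a) / n) with hx
    have hd : 0 ≤ (b - a) / n := div_nonneg (by linarith) hn'.le
    have hx0 : x 0 = a := by simp [hx]
    have hxn : x n = b := by simp only [hx]; field_simp; ring
    have hmem : ∀ i ≤ n, x i ∈ I := by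
      intro i hi
      have hi' : (i : ℝ) ≤ n := by exact_mod_cast hi
      have : x i ≤ x n := by
        simp only [hx]; gcongr
      refine Set.OrdConnected.out ‹_› ha hb ⟨?_, by rwa [hxn] at this⟩
      have : 0 ≤ (i : ℝ) * ((b - a) / n) := by positivity
      simp only [hx]; linarith
    have h1 : ∑ i ∈ Finset.range n, (G (x i) - G (x (i + 1))) ≤
        ∑ i ∈ Finset.range n, (C * ((b - a) / n)) * (h (x (i + 1)) - h (x i)) := by
      refine Finset.sum_le_sum fun i hi => ?_
      have hi := Finset.mem_range.1 hi
      have hst : x (i + 1) - x i = (b - a) / n := by simp only [hx]; push_cast; ring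
      have := H _ (hmem i hi.le) _ (hmem (i + 1) hi) (by linarith)
      rw [hst] at this
      linarith
    rw [Finset.sum_range_sub', ← Finset.mul_sum, Finset.sum_range_sub (fun i => h (x i)), hx0,
      hxn] at h1
    refine h1.trans (le_of_eq ?_)
    field_simp
  have hlim : Tendsto (fun n : ℕ => (C * (h b - h a) * (b - a)) * (1 / (n : ℝ))) atTop (𝓝 0) := by
    simpa using tendsto_one_div_atTop_nhds_zero_nat.const_mul (C * (h b - h a) * (b - a))
  have := ge_of_tendsto hlim (eventually_atTop.2 ⟨1, fun n hn => key n hn⟩)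
  linarith

/-! ### Regularity of the curve and of its curvature -/

namespace Spiral

variable (γ : Spiral)

theorem hasDerivWithinAt_re {s : ℝ} (hs : s ∈ Icc 0 γ.S) :
    HasDerivWithinAt (fun s => (γ.Z s).re) (Real.cos (γ.τ s)) (Icc 0 γ.S) s := by
  have := Complex.reCLM.hasFDerivAt.comp_hasDerivWithinAt s (γ.hasDeriv_Z s hs)
  simpa [Function.comp_def, Complex.exp_ofReal_mul_I_re] using this

theorem hasDerivWithinAt_im {s : ℝ} (hs : s ∈ Icc 0 γ.S) :
    HasDerivWithinAt (fun s => (γ.Z s).im) (Real.sin (γ.τ s)) (Icc 0 γ.S) s := by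
  have := Complex.imCLM.hasFDerivAt.comp_hasDerivWithinAt s (γ.hasDeriv_Z s hs)
  simpa [Function.comp_def, Complex.exp_ofReal_mul_I_im] using this

theorem continuousOn_re : ContinuousOn (fun s => (γ.Z s).re) (Icc 0 γ.S) :=
  fun _ hs => (γ.hasDerivWithinAt_re hs).continuousWithinAt

theorem continuousOn_im : ContinuousOn (fun s => (γ.Z s).im) (Icc 0 γ.S) :=
  fun _ hs => (γ.hasDerivWithinAt_im hs).continuousWithinAt

theorem continuousOn_Z : ContinuousOn γ.Z (Icc 0 γ.S) :=
  fun s hs => (γ.hasDeriv_Z s hs).continuousWithinAt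

theorem continuousOn_τ : ContinuousOn γ.τ (Icc 0 γ.S) := by
  have h := intervalIntegral.continuousOn_primitive_interval'
    (γ.integrable_k) (left_mem_uIcc)
  rw [uIcc_of_le γ.S_pos.le] at h
  exact (h.const_add (γ.τ 0)).congr fun s hs => γ.τ_eq s hs

theorem intervalIntegrable_k {a b : ℝ} (ha : a ∈ Icc 0 γ.S) (hb : b ∈ Icc 0 γ.S) :
    IntervalIntegrable γ.k MeasureTheory.volume a b := by
  refine γ.integrable_k.mono_set ?_
  rw [uIcc_of_le γ.S_pos.le]
  exact Set.uIcc_subset_Icc ha hb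

theorem τ_sub {a b : ℝ} (ha : a ∈ Icc 0 γ.S) (hb : b ∈ Icc 0 γ.S) :
    γ.τ b - γ.τ a = ∫ σ in a..b, γ.k σ := by
  have h0 : (0 : ℝ) ∈ Icc 0 γ.S := ⟨le_rfl, γ.S_pos.le⟩
  rw [γ.τ_eq a ha, γ.τ_eq b hb, ← intervalIntegral.integral_add_adjacent_intervals
    (γ.intervalIntegrable_k h0 ha) (γ.intervalIntegrable_k ha hb)]
  ring

theorem hasDerivAt_τ {s : ℝ} (hs : s ∈ Ioo 0 γ.S) (hk : ContinuousAt γ.k s) :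
    HasDerivAt γ.τ (γ.k s) s := by
  have h0 : (0 : ℝ) ∈ Icc 0 γ.S := ⟨le_rfl, γ.S_pos.le⟩
  have hm : StronglyMeasurableAtFilter γ.k (𝓝 s) := by
    refine ⟨Ioo 0 γ.S, Ioo_mem_nhds hs.1 hs.2, ?_⟩
    have := (intervalIntegrable_iff_integrableOn_Ioo_of_le γ.S_pos.le).1 γ.integrable_k
    exact this.aestronglyMeasurable
  have h := intervalIntegral.integral_hasDerivAt_right
    (γ.intervalIntegrable_k h0 (Ioo_subset_Icc_self hs)) hm hk
  refine (h.const_add (γ.τ 0)).congr_of_eventuallyEq ?_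
  filter_upwards [Ioo_mem_nhds hs.1 hs.2] with t ht using γ.τ_eq t (Ioo_subset_Icc_self ht)

theorem monotoneOn_of_lt (h : γ.k₁ < γ.k₂) : MonotoneOn γ.k (Ioo 0 γ.S) := by
  rcases γ.monotonic_k with hm | hm
  · exact hm
  exfalso
  have hS := γ.S_pos
  have hmid : γ.S / 2 ∈ Ioo 0 γ.S := ⟨by linarith, by linarith⟩
  have h1 : (γ.k (γ.S / 2) : EReal) ≤ γ.k₁ := by
    refine ge_of_tendsto γ.tendsto_k₁ ?_
    filter_upwards [Ioo_mem_nhdsGT hmid.1] with s hs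
    exact_mod_cast hm ⟨hs.1, hs.2.trans hmid.2⟩ hmid hs.2.le
  have h2 : γ.k₂ ≤ (γ.k (γ.S / 2) : EReal) := by
    refine le_of_tendsto γ.tendsto_k₂ ?_
    filter_upwards [Ioo_mem_nhdsLT hmid.2] with s hs
    exact_mod_cast hm hmid ⟨hmid.1.trans hs.1, hs.2⟩ hs.1.le
  exact absurd (h2.trans h1) (not_le.2 h)

theorem k₁_le (h : γ.k₁ < γ.k₂) {s : ℝ} (hs : s ∈ Ioo 0 γ.S) : γ.k₁ ≤ γ.k s := by
  refine le_of_tendsto γ.tendsto_k₁ ?_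
  filter_upwards [Ioo_mem_nhdsGT hs.1] with t ht
  exact_mod_cast γ.monotoneOn_of_lt h ⟨ht.1, ht.2.trans hs.2⟩ hs ht.2.le

theorem le_k₂ (h : γ.k₁ < γ.k₂) {s : ℝ} (hs : s ∈ Ioo 0 γ.S) : γ.k s ≤ γ.k₂ := by
  refine ge_of_tendsto γ.tendsto_k₂ ?_
  filter_upwards [Ioo_mem_nhdsLT hs.2] with t ht
  exact_mod_cast γ.monotoneOn_of_lt h hs ⟨hs.1.trans ht.1, ht.2⟩ ht.1.le

/-- The curvature of a spiral is not constant on the inside of the spiral. -/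
theorem not_forall_k_eq (κ : ℝ) : ¬ ∀ s ∈ Ioo 0 γ.S, γ.k s = κ := by
  intro h
  have hS := γ.S_pos
  have h1 : γ.k₁ = κ := by
    refine tendsto_nhds_unique γ.tendsto_k₁ (tendsto_const_nhds.congr' ?_)
    filter_upwards [Ioo_mem_nhdsGT hS] with s hs
    rw [h s hs]
  have h2 : γ.k₂ = κ := by
    refine tendsto_nhds_unique γ.tendsto_k₂ (tendsto_const_nhds.congr' ?_)
    filter_upwards [Ioo_mem_nhdsLT hS] with s hs
    rw [h s hs]
  exact γ.k₁_ne_k₂ (h1.trans h2.symm)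

/-! ### Tangent circles and the nesting of osculating circles -/

/-- Half the squared distance from the point of parameter `s` to `z`. -/
noncomputable def halfSqDist (s : ℝ) (z : ℂ) : ℝ :=
  ((z.re - (γ.Z s).re) ^ 2 + (z.im - (γ.Z s).im) ^ 2) / 2

/-- The signed distance from `z` to the tangent at `s`, positive on the left of the curve. -/
noncomputable def tangentDist (s : ℝ) (z : ℂ) : ℝ :=
  (z.im - (γ.Z s).im) * Real.cos (γ.τ s) - (z.re - (γ.Z s).re) * Real.sin (γ.τ s)

/-- The position of `z` relative to the circle of curvature `κ` that is tangent to the curve at `s`: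
non-positive on the left side of this circle. -/
noncomputable def contact (κ s : ℝ) (z : ℂ) : ℝ :=
  κ * γ.halfSqDist s z - γ.tangentDist s z

theorem halfSqDist_nonneg (s : ℝ) (z : ℂ) : 0 ≤ γ.halfSqDist s z := by
  unfold halfSqDist; positivity

theorem halfSqDist_pos {s : ℝ} {z : ℂ} (h : γ.Z s ≠ z) : 0 < γ.halfSqDist s z := by
  refine lt_of_le_of_ne (γ.halfSqDist_nonneg s z) fun h0 => h ?_
  unfold halfSqDist at h0
  apply Complex.ext
  · nlinarith [sq_nonneg (z.re - (γ.Z s).re), sq_nonneg (z.im - (γ.Z s).im)]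
  · nlinarith [sq_nonneg (z.re - (γ.Z s).re), sq_nonneg (z.im - (γ.Z s).im)]

theorem continuousOn_halfSqDist (z : ℂ) :
    ContinuousOn (fun s => γ.halfSqDist s z) (Icc 0 γ.S) := by
  have h1 := γ.continuousOn_re
  have h2 := γ.continuousOn_im
  unfold halfSqDist
  fun_prop

theorem continuousOn_contact (κ : ℝ) (z : ℂ) :
    ContinuousOn (fun s => γ.contact κ s z) (Icc 0 γ.S) := by
  have h1 := γ.continuousOn_re
  have h2 := γ.continuousOn_im
  have h3 := γ.continuousOn_τ
  have h4 := Real.continuous_sin.comp_continuousOn h3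
  have h5 := Real.continuous_cos.comp_continuousOn h3
  simp only [Function.comp_def] at h4 h5
  unfold contact halfSqDist tangentDist
  fun_prop

theorem continuousOn_contact_apply (κ s : ℝ) :
    ContinuousOn (fun v => γ.contact κ s (γ.Z v)) (Icc 0 γ.S) := by
  have h1 := γ.continuousOn_re
  have h2 := γ.continuousOn_im
  unfold contact halfSqDist tangentDist
  fun_prop

theorem contact_self (κ s : ℝ) : γ.contact κ s (γ.Z s) = 0 := by
  simp [contact, halfSqDist, tangentDist]

theorem contact_mono {κ κ' : ℝ} (h : κ ≤ κ') (s : ℝ) (z : ℂ) :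
    γ.contact κ s z ≤ γ.contact κ' s z := by
  unfold contact
  have := mul_le_mul_of_nonneg_right h (γ.halfSqDist_nonneg s z)
  linarith

/-- The scalar product of the tangent at `s` and the vector to `z`. -/
noncomputable def tangentProj (s : ℝ) (z : ℂ) : ℝ :=
  (z.re - (γ.Z s).re) * Real.cos (γ.τ s) + (z.im - (γ.Z s).im) * Real.sin (γ.τ s)

/-- Moving the point of contact along the tangent does not change `tangentDist`; only the rotation
of the tangent does. The factor `k s - κ` makes the variation small when `κ` is close to the
curvature. -/
theorem hasDerivAt_contact {s : ℝ} (hs : s ∈ Ioo 0 γ.S) (hk : ContinuousAt γ.k s) (κ : ℝ) (z : ℂ) :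
    HasDerivAt (fun s => γ.contact κ s z) ((γ.k s - κ) * γ.tangentProj s z) s := by
  have hI := Icc_mem_nhds hs.1 hs.2
  have h1 := (γ.hasDerivWithinAt_re (Ioo_subset_Icc_self hs)).hasDerivAt hI
  have h2 := (γ.hasDerivWithinAt_im (Ioo_subset_Icc_self hs)).hasDerivAt hI
  have h3 := γ.hasDerivAt_τ hs hk
  have hx := h1.const_sub z.re
  have hy := h2.const_sub z.im
  have := ((((hx.pow 2).add (hy.pow 2)).div_const 2).const_mul κ).sub
    ((hy.mul h3.cos).sub (hx.mul h3.sin))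
  refine (this.congr_deriv ?_)
  simp only [tangentProj]
  ring

theorem continuousOn_tangentProj (z : ℂ) :
    ContinuousOn (fun s => γ.tangentProj s z) (Icc 0 γ.S) := by
  have h1 := γ.continuousOn_re
  have h2 := γ.continuousOn_im
  have h3 := γ.continuousOn_τ
  have h4 := Real.continuous_sin.comp_continuousOn h3
  have h5 := Real.continuous_cos.comp_continuousOn h3
  simp only [Function.comp_def] at h4 h5
  unfold tangentProj
  fun_prop

theorem exists_tangentProj_bound (z : ℂ) : ∃ C, ∀ s ∈ Icc 0 γ.S, |γ.tangentProj s z| ≤ C := by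
  obtain ⟨C, hC⟩ := isCompact_Icc.exists_bound_of_continuousOn
    (γ.continuousOn_tangentProj z)
  exact ⟨C, fun s hs => by simpa using hC s hs⟩

/-- The derivative on `[a, b]` is at most `C` times the increment of `k`, so the total change is
bounded by a product of two increments, as `monotoneOn_of_sub_le_mul_sub` requires. No derivative of
`k` is needed, and its finitely many jumps are harmless. -/
theorem contact_sub_le (hk : MonotoneOn γ.k (Ioo 0 γ.S)) {z : ℂ} {C : ℝ}
    (hC : ∀ s ∈ Icc 0 γ.S, |γ.tangentProj s z| ≤ C) {a b : ℝ} (ha : a ∈ Ioo 0 γ.S)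
    (hb : b ∈ Ioo 0 γ.S) (hab : a ≤ b) :
    γ.contact (γ.k a) a z - γ.contact (γ.k a) b z ≤ C * (γ.k b - γ.k a) * (b - a) := by
  obtain ⟨F, hF, hFc⟩ := γ.piecewise_continuous_k
  have ha' := Ioo_subset_Icc_self ha
  have hb' := Ioo_subset_Icc_self hb
  have hsub : Icc a b ⊆ Icc 0 γ.S := Icc_subset_Icc ha'.1 hb'.2
  have hsub' : Icc a b ⊆ Ioo 0 γ.S := fun x hx => ⟨ha.1.trans_le hx.1, hx.2.trans_lt hb.2⟩
  have hint := MeasureTheory.integral_eq_of_hasDerivAt_off_countable_of_le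
    (fun s => γ.contact (γ.k a) s z) (fun s => (γ.k s - γ.k a) * γ.tangentProj s z) hab
    hF.countable ((γ.continuousOn_contact _ z).mono hsub)
    (fun x hx => γ.hasDerivAt_contact (hsub' (Ioo_subset_Icc_self hx.1))
      (hFc x ⟨hsub' (Ioo_subset_Icc_self hx.1), hx.2⟩) _ z)
    (((γ.intervalIntegrable_k ha' hb').sub intervalIntegrable_const).mul_continuousOn
      (by rw [uIcc_of_le hab]; exact (γ.continuousOn_tangentProj z).mono hsub))
  have hle := intervalIntegral.norm_integral_le_of_norm_le_const (a := a) (b := b)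
    (C := C * (γ.k b - γ.k a)) (f := fun s => (γ.k s - γ.k a) * γ.tangentProj s z) (by
      intro x hx
      rw [uIoc_of_le hab] at hx
      have hx' : x ∈ Ioo 0 γ.S := hsub' (Ioc_subset_Icc_self hx)
      have h1 := hk ha hx' hx.1.le
      have h2 := hk hx' hb hx.2
      have h3 := hC x (Ioo_subset_Icc_self hx')
      rw [norm_mul, Real.norm_eq_abs, Real.norm_eq_abs, abs_of_nonneg (by linarith), mul_comm]
      exact mul_le_mul h3 (by linarith) (by linarith) ((abs_nonneg _).trans h3))
  rw [hint, abs_of_nonneg (by linarith : 0 ≤ b - a)] at hle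
  have := neg_abs_le (γ.contact (γ.k a) b z - γ.contact (γ.k a) a z)
  rw [Real.norm_eq_abs] at hle
  linarith

/-- Passing from `k a` to `k b` at the point `b` adds at least `m * (k b - k a)`, so monotonicity
survives subtracting `m * k`. With `m = 0` this is Kneser's nesting; with `m > 0` it is the strict
form, which forces `k` to be constant where the contact value is. -/
theorem monotoneOn_contact_sub (hk : MonotoneOn γ.k (Ioo 0 γ.S)) (z : ℂ) {m : ℝ} {I : Set ℝ}
    [I.OrdConnected] (hI : I ⊆ Ioo 0 γ.S) (hm : ∀ s ∈ I, m ≤ γ.halfSqDist s z) :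
    MonotoneOn (fun s => γ.contact (γ.k s) s z - m * γ.k s) I := by
  obtain ⟨C, hC⟩ := γ.exists_tangentProj_bound z
  refine monotoneOn_of_sub_le_mul_sub (C := C) (h := γ.k) fun a ha b hb hab => ?_
  have h1 := γ.contact_sub_le hk hC (hI ha) (hI hb) hab
  have h2 := mul_nonneg (sub_nonneg.2 (hk (hI ha) (hI hb) hab)) (sub_nonneg.2 (hm b hb))
  simp only [contact] at h1 ⊢
  nlinarith

theorem monotoneOn_contact (hk : MonotoneOn γ.k (Ioo 0 γ.S)) (z : ℂ) :
    MonotoneOn (fun s => γ.contact (γ.k s) s z) (Ioo 0 γ.S) := by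
  simpa using γ.monotoneOn_contact_sub hk z (m := 0) (I := Ioo 0 γ.S) subset_rfl
    fun s _ => γ.halfSqDist_nonneg s z

end Spiral

/-! ### Reversal and reflection -/

namespace Spiral

variable (γ : Spiral)

/-- The spiral traversed backwards and turned by `π`. -/
noncomputable def reverse : Spiral where
  S := γ.S
  Z s := -γ.Z (γ.S - s)
  τ s := γ.τ (γ.S - s)
  k s := -γ.k (γ.S - s)
  k₁ := -γ.k₂
  k₂ := -γ.k₁
  S_pos := γ.S_pos
  hasDeriv_Z s hs := by
    have hs' : γ.S - s ∈ Icc 0 γ.S := ⟨by linarith [hs.2], by linarith [hs.1]⟩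
    have h1 : HasDerivWithinAt (fun s => γ.S - s) (-1) (Icc 0 γ.S) s :=
      (hasDerivWithinAt_id s _).const_sub γ.S
    have h2 := (γ.hasDeriv_Z _ hs').scomp s h1
      (fun t ht => ⟨by linarith [ht.2], by linarith [ht.1]⟩)
    exact h2.neg.congr_deriv (by simp)
  integrable_k := by
    have := (γ.integrable_k.comp_sub_left γ.S).symm
    rw [sub_self, sub_zero] at this
    exact this.neg
  τ_eq s hs := by
    have hs' : γ.S - s ∈ Icc 0 γ.S := ⟨by linarith [hs.2], by linarith [hs.1]⟩
    have h := γ.τ_sub hs' (b := γ.S) ⟨γ.S_pos.le, le_rfl⟩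
    rw [intervalIntegral.integral_neg, intervalIntegral.integral_comp_sub_left]
    simp only [sub_zero]
    linarith
  monotonic_k := by
    have hm : ∀ s ∈ Ioo 0 γ.S, γ.S - s ∈ Ioo 0 γ.S :=
      fun s hs => ⟨by linarith [hs.2], by linarith [hs.1]⟩
    refine γ.monotonic_k.imp (fun h a ha b hb hab => ?_) (fun h a ha b hb hab => ?_)
    · exact neg_le_neg (h (hm _ hb) (hm _ ha) (by linarith))
    · exact neg_le_neg (h (hm _ hb) (hm _ ha) (by linarith))
  piecewise_continuous_k := by
    obtain ⟨F, hF, hc⟩ := γ.piecewise_continuous_k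
    refine ⟨(fun s => γ.S - s) '' F, hF.image _, fun s hs => ?_⟩
    have h := hc (γ.S - s) ⟨⟨by linarith [hs.1.2], by linarith [hs.1.1]⟩,
      fun h => hs.2 ⟨_, h, by ring⟩⟩
    exact (ContinuousAt.comp' (f := fun s => γ.S - s) h (by fun_prop)).neg
  tendsto_k₁ := by
    have h1 : Tendsto (fun s => γ.S - s) (𝓝[>] (0 : ℝ)) (𝓝[<] γ.S) := by
      refine tendsto_nhdsWithin_iff.2 ⟨?_, ?_⟩
      · have : Tendsto (fun s => γ.S - s) (𝓝 (0 : ℝ)) (𝓝 (γ.S - 0)) :=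
          (continuous_const.sub continuous_id).tendsto _
        rw [sub_zero] at this
        exact this.mono_left nhdsWithin_le_nhds
      · filter_upwards [self_mem_nhdsWithin] with s hs
        simpa using hs
    have := (continuous_neg.tendsto (γ.k₂)).comp (γ.tendsto_k₂.comp h1)
    simpa [Function.comp_def] using this
  tendsto_k₂ := by
    have h1 : Tendsto (fun s => γ.S - s) (𝓝[<] γ.S) (𝓝[>] (0 : ℝ)) := by
      refine tendsto_nhdsWithin_iff.2 ⟨?_, ?_⟩
      · have : Tendsto (fun s => γ.S - s) (𝓝 γ.S) (𝓝 (γ.S - γ.S)) :=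
          (continuous_const.sub continuous_id).tendsto _
        rw [sub_self] at this
        exact this.mono_left nhdsWithin_le_nhds
      · filter_upwards [self_mem_nhdsWithin] with s hs
        simpa using hs
    have := (continuous_neg.tendsto (γ.k₁)).comp (γ.tendsto_k₁.comp h1)
    simpa [Function.comp_def] using this
  k₁_ne_k₂ h := γ.k₁_ne_k₂ (neg_injective h).symm
  no_circumference p r hr h := by
    refine γ.no_circumference (-p) r hr fun z hz => ?_
    obtain ⟨s, hs, hsz⟩ := h (show -z ∈ Metric.sphere p r by
      rw [mem_sphere_iff_norm] at hz ⊢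
      rw [← hz, ← norm_neg]
      congr 1
      ring)
    exact ⟨γ.S - s, ⟨by linarith [hs.2], by linarith [hs.1]⟩, neg_injective hsz⟩

/-- The mirror image of the spiral in the real axis. -/
noncomputable def mirror : Spiral where
  S := γ.S
  Z s := starRingEnd ℂ (γ.Z s)
  τ s := -γ.τ s
  k s := -γ.k s
  k₁ := -γ.k₁
  k₂ := -γ.k₂
  S_pos := γ.S_pos
  hasDeriv_Z s hs := by
    have h := Complex.conjCLE.hasFDerivAt.comp_hasDerivWithinAt s (γ.hasDeriv_Z s hs)
    simp only [Function.comp_def, ContinuousLinearEquiv.coe_coe, Complex.conjCLE_apply] at h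
    refine h.congr_deriv ?_
    rw [← Complex.exp_conj]
    simp
  integrable_k := γ.integrable_k.neg
  τ_eq s hs := by
    rw [intervalIntegral.integral_neg, γ.τ_eq s hs]
    ring
  monotonic_k := γ.monotonic_k.symm.imp (fun h => h.neg) (fun h => h.neg)
  piecewise_continuous_k := by
    obtain ⟨F, hF, hc⟩ := γ.piecewise_continuous_k
    exact ⟨F, hF, fun s hs => (hc s hs).neg⟩
  tendsto_k₁ := by
    simpa [Function.comp_def] using (continuous_neg.tendsto (γ.k₁)).comp γ.tendsto_k₁
  tendsto_k₂ := by
    simpa [Function.comp_def] using (continuous_neg.tendsto (γ.k₂)).comp γ.tendsto_k₂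
  k₁_ne_k₂ h := γ.k₁_ne_k₂ (neg_injective h)
  no_circumference p r hr h := by
    refine γ.no_circumference (starRingEnd ℂ p) r hr fun z hz => ?_
    obtain ⟨s, hs, hsz⟩ := h (show starRingEnd ℂ z ∈ Metric.sphere p r by
      rw [mem_sphere_iff_norm] at hz ⊢
      rw [← hz, ← Complex.norm_conj]
      simp)
    exact ⟨s, hs, (starRingEnd ℂ).injective hsz⟩

theorem reverse_contact (κ s : ℝ) (z : ℂ) :
    γ.reverse.contact κ s z = -γ.contact (-κ) (γ.S - s) (-z) := by
  simp only [contact, halfSqDist, tangentDist, reverse, Complex.neg_re, Complex.neg_im]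
  ring

/-- Reversal changes both the sign of the curvature and its order, so it stays increasing.
Statements about points ahead of `s` thus yield those about points behind it. -/
theorem reverse_k₁_lt (h : γ.k₁ < γ.k₂) : γ.reverse.k₁ < γ.reverse.k₂ :=
  EReal.neg_lt_neg_iff.2 h

/-! ### Position relative to tangent circles; simplicity of the curve -/

variable {γ}

/-- The curve lies on the left of its tangent circles of smaller curvature, as far as it follows the
point of contact. -/
theorem contact_nonpos (h : γ.k₁ < γ.k₂) {κ s v : ℝ} (hs : 0 ≤ s) (hsv : s ≤ v) (hv : v ≤ γ.S)
    (hκ : ∀ t ∈ Ioo s γ.S, κ ≤ γ.k t) : γ.contact κ s (γ.Z v) ≤ 0 := by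
  have hk := γ.monotoneOn_of_lt h
  rcases hsv.eq_or_lt with rfl | hsv
  · exact (γ.contact_self κ s).le
  -- By nesting, the position of `Z w` relative to the circle at `t < w` is at most that relative to
  -- the circle at `w`, which is zero. The ends `s` and `v` are reached by limits, since `k` carries
  -- no information at `0` and `S`.
  have inner : ∀ t ∈ Ioo s v, γ.contact (γ.k t) t (γ.Z v) ≤ 0 := by
    intro t ht
    have ht' : t ∈ Ioo 0 γ.S := ⟨hs.trans_lt ht.1, ht.2.trans_le hv⟩
    have hw : ∀ w ∈ Ioo t v, γ.contact (γ.k t) t (γ.Z w) ≤ 0 := by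
      intro w hw
      have := γ.monotoneOn_contact hk (γ.Z w) ht' ⟨ht'.1.trans hw.1, hw.2.trans_le hv⟩ hw.1.le
      simpa [contact_self] using this
    have hc : Tendsto (fun w => γ.contact (γ.k t) t (γ.Z w)) (𝓝[<] v)
        (𝓝 (γ.contact (γ.k t) t (γ.Z v))) :=
      (γ.continuousOn_contact_apply (γ.k t) t v ⟨by linarith, hv⟩).mono_left
        (nhdsWithin_le_of_mem (Icc_mem_nhdsLT_of_mem ⟨by linarith, hv⟩))
    refine le_of_tendsto hc ?_
    filter_upwards [Ioo_mem_nhdsLT ht.2] with w hw' using hw w hw'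
  have hc : Tendsto (fun t => γ.contact κ t (γ.Z v)) (𝓝[>] s) (𝓝 (γ.contact κ s (γ.Z v))) :=
    (γ.continuousOn_contact κ (γ.Z v) s ⟨hs, by linarith⟩).mono_left
      (nhdsWithin_le_of_mem (Icc_mem_nhdsGT_of_mem ⟨hs, by linarith⟩))
  refine le_of_tendsto hc ?_
  filter_upwards [Ioo_mem_nhdsGT hsv] with t ht
  exact (γ.contact_mono (hκ t ⟨ht.1, ht.2.trans_le hv⟩) t _).trans (inner t ht)

theorem contact_nonneg (h : γ.k₁ < γ.k₂) {κ s u : ℝ} (hu : 0 ≤ u) (hus : u ≤ s) (hs : s ≤ γ.S)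
    (hκ : ∀ t ∈ Ioo 0 s, γ.k t ≤ κ) : 0 ≤ γ.contact κ s (γ.Z u) := by
  have := contact_nonpos (γ := γ.reverse) (γ.reverse_k₁_lt h) (κ := -κ) (s := γ.S - s)
    (v := γ.S - u) (by linarith) (by linarith) (by change γ.S - u ≤ γ.S; linarith)
    (fun t ht => neg_le_neg (hκ (γ.S - t) ⟨by have := ht.2; change t < γ.S at this; linarith,
      by linarith [ht.1]⟩))
  rw [reverse_contact] at this
  simpa [reverse] using this

/-- Second contact with a tangent circle is possible only if the curve follows this circle. -/
theorem k_eq_of_contact_eq_zero (h : γ.k₁ < γ.k₂) {κ s v : ℝ} (hs : 0 ≤ s) (hsv : s < v)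
    (hv : v ≤ γ.S) (hκ : ∀ t ∈ Ioo s γ.S, κ ≤ γ.k t) (hZ : ∀ t ∈ Ico s v, γ.Z t ≠ γ.Z v)
    (h0 : γ.contact κ s (γ.Z v) = 0) : ∀ t ∈ Ioo s v, γ.k t = κ := by
  have hk := γ.monotoneOn_of_lt h
  have hin : ∀ t ∈ Ioo s v, t ∈ Ioo 0 γ.S :=
    fun t ht => ⟨hs.trans_lt ht.1, ht.2.trans_le hv⟩
  have hlim : ∀ κ', Tendsto (fun t => γ.contact κ' t (γ.Z v)) (𝓝[>] s)
      (𝓝 (γ.contact κ' s (γ.Z v))) := fun κ' =>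
    (γ.continuousOn_contact κ' (γ.Z v) s ⟨hs, by linarith⟩).mono_left
      (nhdsWithin_le_of_mem (Icc_mem_nhdsGT_of_mem ⟨hs, by linarith⟩))
  -- The values are nonpositive and increase in `t`, while their values near `s` are bounded below
  -- by a quantity tending to zero.
  have hG : ∀ t ∈ Ioo s v, γ.contact (γ.k t) t (γ.Z v) = 0 := by
    intro t ht
    refine le_antisymm (contact_nonpos h (hin t ht).1.le ht.2.le hv
      fun t' ht' => hk (hin t ht) ⟨(hin t ht).1.trans ht'.1, ht'.2⟩ ht'.1.le) ?_
    rw [← h0]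
    refine le_of_tendsto (hlim κ) ?_
    filter_upwards [Ioo_mem_nhdsGT ht.1] with t' ht'
    have ht'' : t' ∈ Ioo s v := ⟨ht'.1, ht'.2.trans ht.2⟩
    exact (γ.contact_mono (hκ t' ⟨ht'.1, (hin t' ht'').2⟩) t' _).trans
      (γ.monotoneOn_contact hk (γ.Z v) (hin t' ht'') (hin t ht) ht'.2.le)
  intro t ht
  have hsub : Icc s t ⊆ Icc 0 γ.S := Icc_subset_Icc hs (ht.2.le.trans hv)
  obtain ⟨x, hx, hmin⟩ := isCompact_Icc.exists_isMinOn (nonempty_Icc.2 ht.1.le)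
    ((γ.continuousOn_halfSqDist (γ.Z v)).mono hsub)
  -- The minimal distance to `Z v` over `[s, t]` is positive, so the strict form of nesting applies.
  have hm := γ.halfSqDist_pos (hZ x ⟨hx.1, hx.2.trans_lt ht.2⟩)
  have hconst : ∀ t' ∈ Ioo s t, γ.k t' = γ.k t := by
    intro t' ht'
    have ht'' : t' ∈ Ioo s v := ⟨ht'.1, ht'.2.trans ht.2⟩
    refine le_antisymm (hk (hin t' ht'') (hin t ht) ht'.2.le) ?_
    have := γ.monotoneOn_contact_sub hk (γ.Z v) (I := Ioc s t)
      (fun y hy => hin y ⟨hy.1, hy.2.trans_lt ht.2⟩)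
      (fun y hy => isMinOn_iff.1 hmin y (Ioc_subset_Icc_self hy))
      ⟨ht'.1, ht'.2.le⟩ ⟨ht.1, le_rfl⟩ ht'.2.le
    simp only [hG t' ht'', hG t ht] at this
    exact le_of_mul_le_mul_left (by linarith) hm
  -- Two curvatures with zero contact at the same `s` and `Z v ≠ Z s` coincide, which identifies the
  -- constant with `κ`.
  have h1 : γ.contact (γ.k t) s (γ.Z v) = 0 := by
    refine tendsto_nhds_unique (hlim (γ.k t)) (tendsto_const_nhds.congr' ?_)
    filter_upwards [Ioo_mem_nhdsGT ht.1] with t' ht'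
    rw [← hconst t' ht', hG t' ⟨ht'.1, ht'.2.trans ht.2⟩]
  have h2 := γ.halfSqDist_pos (hZ s ⟨le_rfl, hsv⟩)
  unfold contact at h0 h1
  have : (γ.k t - κ) * γ.halfSqDist s (γ.Z v) = 0 := by linarith
  rcases mul_eq_zero.1 this with h | h <;> linarith

theorem τ_eq_of_k_eq {κ u v : ℝ} (hu : 0 ≤ u) (hv : v ≤ γ.S)
    (hk : ∀ t ∈ Ioo u v, γ.k t = κ) {t : ℝ} (ht : t ∈ Icc u v) :
    γ.τ t = γ.τ u + κ * (t - u) := by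
  have h := γ.τ_sub (a := u) (b := t) ⟨hu, by linarith [ht.1, ht.2]⟩
    ⟨by linarith [ht.1], by linarith [ht.2]⟩
  have h2 : ∫ σ in u..t, γ.k σ = ∫ _ in u..t, κ := by
    rw [intervalIntegral.integral_of_le ht.1, intervalIntegral.integral_of_le ht.1,
      MeasureTheory.integral_Ioc_eq_integral_Ioo, MeasureTheory.integral_Ioc_eq_integral_Ioo]
    exact MeasureTheory.setIntegral_congr_fun measurableSet_Ioo
      fun x hx => hk x ⟨hx.1, hx.2.trans_le ht.2⟩
  rw [h2, intervalIntegral.integral_const, smul_eq_mul] at h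
  linarith

/-- A straight segment does not close up. An arc of nonzero constant curvature closes only after
turning by a nonzero multiple of `2π`, and then it covers its whole circle. -/
theorem not_closed_of_k_eq {κ u v : ℝ} (hu : 0 ≤ u) (huv : u < v) (hv : v ≤ γ.S)
    (hk : ∀ t ∈ Ioo u v, γ.k t = κ) : γ.Z u ≠ γ.Z v := by
  intro huv'
  have hτ := fun t (ht : t ∈ Icc u v) => τ_eq_of_k_eq (γ := γ) hu hv hk ht
  have hsub : Icc u v ⊆ Icc 0 γ.S := Icc_subset_Icc hu hv
  have hZ : ∀ t ∈ Ico u v, HasDerivWithinAt γ.Z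
      (Complex.exp (((γ.τ u + κ * (t - u) : ℝ) : ℂ) * Complex.I)) (Ici t) t := by
    intro t ht
    rw [← hτ t (Ico_subset_Icc_self ht)]
    exact (γ.hasDeriv_Z t (hsub (Ico_subset_Icc_self ht))).mono_of_mem_nhdsWithin
      (Icc_mem_nhdsGE_of_mem ⟨hu.trans ht.1, ht.2.trans_le hv⟩)
  have hv' : v ∈ Icc u v := ⟨huv.le, le_rfl⟩
  rcases eq_or_ne κ 0 with rfl | hκ
  · have hc : ∀ t ∈ Icc u v, γ.Z t - (t : ℂ) * Complex.exp ((γ.τ u : ℂ) * Complex.I) =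
        γ.Z u - (u : ℂ) * Complex.exp ((γ.τ u : ℂ) * Complex.I) := by
      refine constant_of_has_deriv_right_zero
        ((γ.continuousOn_Z.mono hsub).sub (by fun_prop)) fun t ht => ?_
      have h1 : HasDerivWithinAt (fun t : ℝ => (t : ℂ) * Complex.exp ((γ.τ u : ℂ) * Complex.I))
          (1 * Complex.exp ((γ.τ u : ℂ) * Complex.I)) (Ici t) t :=
        ((Complex.ofRealCLM.hasDerivAt (x := t)).mul_const _).hasDerivWithinAt
      refine ((hZ t ht).sub h1).congr_deriv ?_
      simp
    have h1 := hc v hv'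
    have h2 : ((v : ℂ) - u) * Complex.exp ((γ.τ u : ℂ) * Complex.I) = 0 := by
      linear_combination -h1 - huv'
    rcases mul_eq_zero.1 h2 with h | h
    · exact huv.ne' (by exact_mod_cast sub_eq_zero.1 h)
    · exact Complex.exp_ne_zero _ h
  · have hκ' : (κ : ℂ) ≠ 0 := by exact_mod_cast hκ
    -- The invariant is `κ` times the centre of curvature, later called `p`.
    have hc : ∀ t ∈ Icc u v, κ * γ.Z t + Complex.I *
          Complex.exp (((γ.τ u + κ * (t - u) : ℝ) : ℂ) * Complex.I) =
        κ * γ.Z u + Complex.I *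
          Complex.exp (((γ.τ u + κ * (u - u) : ℝ) : ℂ) * Complex.I) := by
      refine constant_of_has_deriv_right_zero
        ((continuousOn_const.mul (γ.continuousOn_Z.mono hsub)).add (by fun_prop)) fun t ht => ?_
      have h1 : HasDerivAt (fun t : ℝ => γ.τ u + κ * (t - u)) κ t := by
        simpa using (((hasDerivAt_id t).sub_const u).const_mul κ).const_add (γ.τ u)
      have h2 := ((h1.ofReal_comp.mul_const Complex.I).cexp.const_mul
        Complex.I).hasDerivWithinAt (s := Ici t)
      refine (((hZ t ht).const_mul (κ : ℂ)).add h2).congr_deriv ?_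
      linear_combination κ * Complex.exp (((γ.τ u + κ * (t - u) : ℝ) : ℂ) * Complex.I) *
        Complex.I_mul_I
    have h1 := hc v hv'
    rw [huv', add_right_inj, mul_right_inj' Complex.I_ne_zero, Complex.exp_eq_exp_iff_exists_int]
      at h1
    obtain ⟨n, hn⟩ := h1
    have hn' : κ * (v - u) = 2 * Real.pi * n := by
      have := congrArg Complex.im hn
      simp at this
      linarith
    have hn0 : n ≠ 0 := by
      rintro rfl
      have : κ * (v - u) = 0 := by simpa using hn'
      rcases mul_eq_zero.1 this with h | h
      · exact hκ h
      · linarith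
    have hlen : 2 * Real.pi ≤ |γ.τ v - γ.τ u| := by
      rw [hτ v hv', add_sub_cancel_left, hn', abs_mul, abs_of_pos Real.two_pi_pos]
      have : (1 : ℝ) ≤ |(n : ℝ)| := by exact_mod_cast Int.one_le_abs hn0
      nlinarith [Real.two_pi_pos]
    set p : ℂ := γ.Z u + Complex.I * Complex.exp ((γ.τ u : ℂ) * Complex.I) / κ with hp
    refine γ.no_circumference p |κ|⁻¹ (inv_pos.2 (abs_pos.2 hκ)) fun q hq => ?_
    rw [mem_sphere_iff_norm] at hq
    have hunit : ‖Complex.I * κ * (q - p)‖ = 1 := by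
      rw [norm_mul, norm_mul, hq, Complex.norm_I, Complex.norm_real, Real.norm_eq_abs, one_mul,
        mul_inv_cancel₀ (abs_ne_zero.2 hκ)]
    -- A point `q` of the circle is reached when the tangent angle equals `θ` modulo `2π`. The range
    -- of `τ` has length at least `2π`, so it contains such a value.
    obtain ⟨θ, hθ⟩ := (Complex.norm_eq_one_iff _).1 hunit
    obtain ⟨θ', hθ', hθθ'⟩ : ∃ θ' ∈ uIcc (γ.τ u) (γ.τ v),
        Complex.exp ((θ' : ℂ) * Complex.I) = Complex.exp ((θ : ℂ) * Complex.I) := by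
      refine ⟨toIcoMod Real.two_pi_pos (min (γ.τ u) (γ.τ v)) θ, ?_, ?_⟩
      · have := toIcoMod_mem_Ico Real.two_pi_pos (min (γ.τ u) (γ.τ v)) θ
        refine ⟨this.1, this.2.le.trans ?_⟩
        rw [← max_sub_min_eq_abs] at hlen
        linarith
      · rw [Complex.exp_eq_exp_iff_exists_int]
        refine ⟨-toIcoDiv Real.two_pi_pos (min (γ.τ u) (γ.τ v)) θ, ?_⟩
        rw [toIcoMod]
        push_cast
        simp
        ring
    obtain ⟨t, ht, htθ⟩ := intermediate_value_uIcc
      (by rw [uIcc_of_le huv.le]; exact γ.continuousOn_τ.mono hsub) hθ'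
    rw [uIcc_of_le huv.le] at ht
    refine ⟨t, hsub ht, ?_⟩
    have h2 := hc t ht
    rw [← hτ t ht, htθ, hθθ', hθ, sub_self, mul_zero, add_zero] at h2
    have h3 : κ * p = κ * γ.Z u + Complex.I * Complex.exp ((γ.τ u : ℂ) * Complex.I) := by
      rw [hp]; field_simp
    refine mul_left_cancel₀ hκ' ?_
    linear_combination h2 - h3 - κ * (q - p) * Complex.I_mul_I

/-- On a first return loop, the common endpoint lies both ahead of and behind each inner point `s`,
so it is on the osculating circle at `s`. Second contact makes the curvature constant on the loop,
which `not_closed_of_k_eq` excludes. -/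
theorem Z_ne (h : γ.k₁ < γ.k₂) {u v : ℝ} (hu : 0 ≤ u) (huv : u < v) (hv : v ≤ γ.S) :
    γ.Z u ≠ γ.Z v := by
  intro huv'
  have hk := γ.monotoneOn_of_lt h
  -- The nonzero velocity at `u` keeps returns away from `u`, so there is a first one, `v'`.
  have hiso := (γ.hasDeriv_Z u ⟨hu, by linarith⟩).eventually_ne (c := γ.Z v)
    (Complex.exp_ne_zero _)
  have hiso' : ∀ᶠ t in 𝓝[>] u, γ.Z t ≠ γ.Z v := by
    have hsub : Ioc u γ.S ⊆ Icc 0 γ.S \ {u} :=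
      fun t ht => ⟨⟨hu.trans ht.1.le, ht.2⟩, ht.1.ne'⟩
    refine hiso.filter_mono (le_trans ?_ (nhdsWithin_mono u hsub))
    exact nhdsWithin_le_of_mem (Ioc_mem_nhdsGT (by linarith))
  obtain ⟨w, hw, hwZ⟩ := mem_nhdsGT_iff_exists_Ioo_subset.1 hiso'
  have hwu : u < w := hw
  have hwv : w ≤ v := by
    by_contra hlt
    exact hwZ ⟨huv, not_le.1 hlt⟩ rfl
  have hsub : Icc w v ⊆ Icc 0 γ.S := Icc_subset_Icc (by linarith) hv
  have hcl : IsClosed (Icc w v ∩ γ.Z ⁻¹' {γ.Z v}) :=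
    (γ.continuousOn_Z.mono hsub).preimage_isClosed_of_isClosed isClosed_Icc isClosed_singleton
  obtain ⟨v', ⟨hv'1, hv'2⟩, hv'min⟩ :=
    (isCompact_Icc.of_isClosed_subset hcl inter_subset_left).exists_isLeast
      ⟨v, (⟨⟨hwv, le_rfl⟩, rfl⟩ : v ∈ Icc w v ∩ γ.Z ⁻¹' {γ.Z v})⟩
  have hv'2 : γ.Z v' = γ.Z v := hv'2
  have huv1 : u < v' := hwu.trans_le hv'1.1
  have hne : ∀ t ∈ Ioo u v', γ.Z t ≠ γ.Z v' := by
    intro t ht hEq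
    rcases lt_or_ge t w with htw | htw
    · exact hwZ ⟨ht.1, htw⟩ (hEq.trans hv'2)
    · exact absurd (hv'min ⟨⟨htw, ht.2.le.trans hv'1.2⟩, hEq.trans hv'2⟩) (not_le.2 ht.2)
  have hin : ∀ t ∈ Ioo u v', t ∈ Ioo 0 γ.S :=
    fun t ht => ⟨hu.trans_lt ht.1, ht.2.trans_le (hv'1.2.trans hv)⟩
  have hconst : ∀ s ∈ Ioo u v', ∀ t ∈ Ioo s v', γ.k t = γ.k s := by
    intro s hs
    have hr : ∀ t ∈ Ioo s γ.S, γ.k s ≤ γ.k t := fun t ht =>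
      hk (hin s hs) ⟨(hin s hs).1.trans ht.1, ht.2⟩ ht.1.le
    have hl : ∀ t ∈ Ioo 0 s, γ.k t ≤ γ.k s := fun t ht =>
      hk ⟨ht.1, ht.2.trans (hin s hs).2⟩ (hin s hs) ht.2.le
    refine k_eq_of_contact_eq_zero h (hin s hs).1.le hs.2 (hv'1.2.trans hv) hr
      (fun t ht => hne t ⟨hs.1.trans_le ht.1, ht.2⟩) (le_antisymm ?_ ?_)
    · exact contact_nonpos h (hin s hs).1.le hs.2.le (hv'1.2.trans hv) hr
    · rw [hv'2, ← huv']
      exact contact_nonneg h hu hs.1.le (hin s hs).2.le hl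
  have hmid : (u + v') / 2 ∈ Ioo u v' := ⟨by linarith, by linarith⟩
  refine not_closed_of_k_eq hu huv1 (hv'1.2.trans hv) (κ := γ.k ((u + v') / 2))
    (fun t ht => ?_) (huv'.trans hv'2.symm)
  rcases lt_trichotomy t ((u + v') / 2) with hlt | rfl | hlt
  · exact (hconst t ht _ ⟨hlt, hmid.2⟩).symm
  · rfl
  · exact hconst _ hmid t ⟨hlt, ht.2⟩

end Spiral

/-! ### Counting crossings in one direction -/

section Crossing

variable {g : ℝ → ℝ} {a b L : ℝ}

/-- A continuous function that crosses the level `L` only downwards stays below it. -/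
theorem lt_of_forall_crossing (hg : ContinuousOn g (Icc a b))
    (hr : ∀ x ∈ Ico a b, g x = L → ∀ᶠ y in 𝓝[>] x, g y < L)
    (hl : ∀ x ∈ Ioo a b, g x = L → ∀ᶠ y in 𝓝[<] x, L < g y) (hb : g b ≠ L) {x y : ℝ}
    (hx : x ∈ Icc a b) (hy : y ∈ Icc a b) (hxy : x < y) (hgx : g x ≤ L) : g y < L := by
  by_contra! hLy
  obtain ⟨x', hxx', hx'y, hgx'⟩ : ∃ x', x ≤ x' ∧ x' < y ∧ g x' < L := by
    rcases hgx.lt_or_eq with h | h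
    · exact ⟨x, le_rfl, hxy, h⟩
    · obtain ⟨x', h1, h2⟩ := ((hr x ⟨hx.1, hxy.trans_le hy.2⟩ h).and (Ioo_mem_nhdsGT hxy)).exists
      exact ⟨x', h2.1.le, h2.2, h1⟩
  have hsub : Icc x' y ⊆ Icc a b := Icc_subset_Icc (hx.1.trans hxx') hy.2
  -- At the first `z` after `x'` that reaches the level, `g z = L`, but `hl` puts `g` above `L` just
  -- before `z`. The assumption on `g b` keeps `z` inside, where `hl` is available.
  have hcl : IsClosed (Icc x' y ∩ g ⁻¹' Ici L) :=
    (hg.mono hsub).preimage_isClosed_of_isClosed isClosed_Icc isClosed_Ici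
  obtain ⟨z, ⟨hz1, hz2⟩, hzmin⟩ :=
    (isCompact_Icc.of_isClosed_subset hcl inter_subset_left).exists_isLeast
      ⟨y, (⟨⟨hx'y.le, le_rfl⟩, hLy⟩ : y ∈ Icc x' y ∩ g ⁻¹' Ici L)⟩
  have hz2 : L ≤ g z := hz2
  have hx'z : x' < z := lt_of_le_of_ne hz1.1 (by rintro rfl; linarith)
  have hbelow : ∀ w ∈ Ioo x' z, g w < L := fun w hw => by
    by_contra! h
    exact absurd (hzmin ⟨⟨hw.1.le, hw.2.le.trans hz1.2⟩, h⟩) (not_le.2 hw.2)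
  have hzL : g z = L := by
    refine le_antisymm ?_ hz2
    have hc : Tendsto g (𝓝[<] z) (𝓝 (g z)) :=
      (hg z (hsub hz1)).mono_left (nhdsWithin_le_of_mem
        (Icc_mem_nhdsLT_of_mem ⟨(hx.1.trans hxx').trans_lt hx'z, (hsub hz1).2⟩))
    refine le_of_tendsto hc ?_
    filter_upwards [Ioo_mem_nhdsLT hx'z] with w hw using (hbelow w hw).le
  have hzb : z < b := lt_of_le_of_ne (hsub hz1).2 (by rintro rfl; exact hb hzL)
  obtain ⟨w, h1, h2⟩ := ((hl z ⟨(hx.1.trans hxx').trans_lt hx'z, hzb⟩ hzL).and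
    (Ioo_mem_nhdsLT hx'z)).exists
  exact lt_asymm h1 (hbelow w h2)

/-- If an angle passes the direction opposite to the `x`-axis only clockwise, then the number of
these passages is determined by the boundary values of the angle. -/
theorem finite_and_ncard_of_forall_crossing {m₀ j : ℤ} (hab : a ≤ b)
    (hg : ContinuousOn g (Icc a b))
    (hr : ∀ x ∈ Ico a b, Real.cos (g x) = -1 → ∀ᶠ y in 𝓝[>] x, g y < g x)
    (hl : ∀ x ∈ Ioo a b, Real.cos (g x) = -1 → ∀ᶠ y in 𝓝[<] x, g x < g y)
    (ha : g a ∈ Ioc (2 * Real.pi * m₀ - Real.pi) (2 * Real.pi * m₀ + Real.pi))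
    (hb : g b ∈ Ioo (2 * Real.pi * j - Real.pi) (2 * Real.pi * j + Real.pi)) :
    {x | x ∈ Ioo a b ∧ Real.cos (g x) = -1}.Finite ∧
      ({x | x ∈ Ioo a b ∧ Real.cos (g x) = -1}.ncard : ℤ) = m₀ - j := by
  have hpi := Real.pi_pos
  have hcos : ∀ (m : ℤ) (x : ℝ), g x = 2 * Real.pi * m + Real.pi → Real.cos (g x) = -1 := by
    intro m x hx
    rw [Real.cos_eq_neg_one_iff]
    exact ⟨m, by rw [hx]; ring⟩
  have hbne : ∀ m : ℤ, g b ≠ 2 * Real.pi * m + Real.pi := by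
    intro m hm
    rw [hm] at hb
    have h1 : (j : ℝ) - 1 < m := by
      by_contra! h
      nlinarith [hb.1]
    have h2 : (m : ℝ) < j := by
      by_contra! h
      nlinarith [hb.2]
    have h1 : j - 1 < m := by exact_mod_cast h1
    have h2 : m < j := by exact_mod_cast h2
    omega
  have hlt : ∀ m : ℤ, ∀ x ∈ Icc a b, ∀ y ∈ Icc a b, x < y → g x ≤ 2 * Real.pi * m + Real.pi →
      g y < 2 * Real.pi * m + Real.pi := by
    intro m x hx y hy hxy hgx
    refine lt_of_forall_crossing hg (fun x hx h => ?_) (fun x hx h => ?_) (hbne m) hx hy hxy hgx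
    · rw [← h]
      exact hr x hx (hcos m x h)
    · rw [← h]
      exact hl x hx (hcos m x h)
  have hjm : j ≤ m₀ := by
    have h1 : g b < 2 * Real.pi * m₀ + Real.pi := by
      rcases hab.eq_or_lt with rfl | hab
      · exact lt_of_le_of_ne ha.2 (hbne m₀)
      · exact hlt m₀ a ⟨le_rfl, hab.le⟩ b ⟨hab.le, le_rfl⟩ hab ha.2
    have h2 : (j : ℝ) < m₀ + 1 := by
      by_contra! h
      nlinarith [hb.1]
    have h2 : j < m₀ + 1 := by exact_mod_cast h2
    omega
  -- The levels taken inside are exactly those with `j ≤ m < m₀`, each once. Level `m₀` can be met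
  -- only at the start `a`, which is not counted.
  have hex : ∀ m : ℤ, m ∈ Finset.Ico j m₀ → ∃ x ∈ Ioo a b, g x = 2 * Real.pi * m + Real.pi := by
    intro m hm
    rw [Finset.mem_Ico] at hm
    have h1 : (j : ℝ) ≤ m := by exact_mod_cast hm.1
    have h2 : (m : ℝ) + 1 ≤ m₀ := by exact_mod_cast hm.2
    exact intermediate_value_Ioo' hab hg ⟨by nlinarith [hb.2], by nlinarith [ha.1]⟩
  choose! X hX hgX using hex
  have hset : {x | x ∈ Ioo a b ∧ Real.cos (g x) = -1} = X '' (Finset.Ico j m₀ : Set ℤ) := by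
    ext x
    constructor
    · rintro ⟨hx, hcx⟩
      obtain ⟨m, hm⟩ := Real.cos_eq_neg_one_iff.1 hcx
      have hm : g x = 2 * Real.pi * m + Real.pi := by linarith
      have hx' := Ioo_subset_Icc_self hx
      have h1 : j ≤ m := by
        have := hlt m x hx' b ⟨hab, le_rfl⟩ hx.2 hm.le
        have h2 : (j : ℝ) < m + 1 := by
          by_contra! h
          nlinarith [hb.1]
        have h2 : j < m + 1 := by exact_mod_cast h2
        omega
      have h2 : m < m₀ := by
        by_contra! h
        have h' : (m₀ : ℝ) ≤ m := by exact_mod_cast h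
        have := hlt m a ⟨le_rfl, hab⟩ x hx' hx.1 (by nlinarith [ha.2])
        linarith
      have hmem : m ∈ Finset.Ico j m₀ := Finset.mem_Ico.2 ⟨h1, h2⟩
      refine ⟨m, hmem, ?_⟩
      have hXm := Ioo_subset_Icc_self (hX m hmem)
      rcases lt_trichotomy (X m) x with h | h | h
      · exact absurd hm (hlt m _ hXm _ hx' h (hgX m hmem).le).ne
      · exact h
      · exact absurd (hgX m hmem) (hlt m _ hx' _ hXm h hm.le).ne
    · rintro ⟨m, hm, rfl⟩
      exact ⟨hX m hm, hcos m _ (hgX m hm)⟩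
  have hinj : InjOn X (Finset.Ico j m₀ : Set ℤ) := by
    intro m hm m' hm' h
    have h1 := hgX m hm
    rw [h, hgX m' hm'] at h1
    have : (m' : ℝ) = m := by
      have h2 : 2 * Real.pi * ((m' : ℝ) - m) = 0 := by linarith
      rcases mul_eq_zero.1 h2 with h3 | h3 <;> linarith
    exact_mod_cast this.symm
  rw [hset]
  refine ⟨(Finset.finite_toSet _).image _, ?_⟩
  rw [hinj.ncard_image, ncard_coe_finset, Int.card_Ico, Int.toNat_of_nonneg (by omega)]

end Crossing

/-- Here `sin y = -sin (y - x)`: near the direction of the negative axis, the upper half-plane lies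
clockwise. -/
theorem Real.lt_of_cos_eq_neg_one_of_sin_pos {x y : ℝ} (hx : Real.cos x = -1)
    (hy : 0 < Real.sin y) (hxy : |y - x| < Real.pi) : y < x := by
  by_contra! h
  have hs : Real.sin x = 0 := by
    have := Real.sin_sq_add_cos_sq x
    rw [hx] at this
    nlinarith
  have h1 : Real.sin y = -Real.sin (y - x) := by
    rw [Real.sin_sub, hx, hs]; ring
  have h2 := Real.sin_nonneg_of_nonneg_of_le_pi (sub_nonneg.2 h) ((le_abs_self _).trans hxy.le)
  linarith

theorem Real.lt_of_cos_eq_neg_one_of_sin_neg {x y : ℝ} (hx : Real.cos x = -1)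
    (hy : Real.sin y < 0) (hxy : |y - x| < Real.pi) : x < y := by
  have := Real.lt_of_cos_eq_neg_one_of_sin_pos (x := -x) (y := -y) (by simpa using hx)
    (by simpa using hy) (by rw [← abs_neg]; convert hxy using 2; ring)
  linarith

/-! ### Directions at split points and on the complement of the chord -/

namespace Spiral

/-- A point that separates non-positive and non-negative values of the curvature. -/
def IsSplitPoint (γ : Spiral) (s : ℝ) : Prop :=
  s ∈ Icc 0 γ.S ∧ (∀ t ∈ Ioo 0 s, γ.k t ≤ 0) ∧ ∀ t ∈ Ioo s γ.S, 0 ≤ γ.k t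

variable {γ : Spiral} {c : ℝ}

theorem IsReferencePoint.isSplitPoint (h : γ.k₁ < γ.k₂) {s₀ : ℝ} (hs₀ : γ.IsReferencePoint s₀) :
    γ.IsSplitPoint s₀ := by
  have hS := γ.S_pos.le
  rcases hs₀ with ⟨hs, ⟨-, -, hl, hr⟩ | ⟨h1, h2, -, -⟩⟩ | ⟨⟨h1, -⟩ | ⟨h1, -⟩, rfl⟩ |
    ⟨⟨-, h2⟩ | ⟨-, h2⟩, rfl⟩
  · exact ⟨Ioo_subset_Icc_self hs, hl, hr⟩
  · exact absurd (h1.trans (h.trans h2)) (lt_irrefl _)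
  · refine ⟨⟨le_rfl, hS⟩, by simp, fun t ht => ?_⟩
    exact_mod_cast h1.trans (γ.k₁_le h ht)
  · exact absurd (h.trans h1) (lt_irrefl _)
  · refine ⟨⟨hS, le_rfl⟩, fun t ht => ?_, by simp⟩
    exact_mod_cast (γ.le_k₂ h ht).trans h2
  · exact absurd (h.trans h2) (lt_irrefl _)

/-- Second contact on either side of `s` makes the curvature equal to `κ` there, hence everywhere.
This turns the weak separation of the two endpoints into a strict one. -/
theorem not_contact_both (h : γ.k₁ < γ.k₂) {κ s : ℝ} (hs : s ∈ Icc 0 γ.S)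
    (hl : ∀ t ∈ Ioo 0 s, γ.k t ≤ κ) (hr : ∀ t ∈ Ioo s γ.S, κ ≤ γ.k t)
    (h0 : γ.contact κ s (γ.Z 0) = 0) (hS : γ.contact κ s (γ.Z γ.S) = 0) : False := by
  have hR : ∀ t ∈ Ioo s γ.S, γ.k t = κ := by
    rcases hs.2.eq_or_lt with rfl | hlt
    · simp
    · exact k_eq_of_contact_eq_zero h hs.1 hlt le_rfl hr
        (fun t ht => Z_ne h (hs.1.trans ht.1) ht.2 le_rfl) hS
  have hL : ∀ t ∈ Ioo 0 s, γ.k t = κ := by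
    rcases hs.1.eq_or_lt with rfl | hlt
    · simp
    · intro t ht
      have h' := γ.reverse_k₁_lt h
      have := k_eq_of_contact_eq_zero (γ := γ.reverse) (κ := -κ) (s := γ.S - s) (v := γ.S) h'
        (by linarith [hs.2]) (by linarith) le_rfl
        (fun t ht => neg_le_neg (hl (γ.S - t)
          ⟨sub_pos.2 ht.2, by linarith [ht.1]⟩))
        (fun t ht => Z_ne h' (by linarith [ht.1, hs.2]) ht.2 le_rfl)
        (by rw [reverse_contact]; simpa [reverse] using h0)
        (γ.S - t) ⟨by linarith [ht.2], by linarith [ht.1]⟩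
      simpa [reverse] using this
  refine γ.not_forall_k_eq κ fun t ht => ?_
  rcases lt_trichotomy t s with hlt | rfl | hlt
  · exact hL t ⟨ht.1, hlt⟩
  · have hk := γ.monotoneOn_of_lt h
    refine le_antisymm ?_ ?_
    · have hm : (t + γ.S) / 2 ∈ Ioo t γ.S := ⟨by linarith [ht.2], by linarith [ht.2]⟩
      rw [← hR _ hm]
      exact hk ht ⟨ht.1.trans hm.1, hm.2⟩ hm.1.le
    · have hm : t / 2 ∈ Ioo 0 t := ⟨by linarith [ht.1], by linarith [ht.1]⟩
      rw [← hL _ hm]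
      exact hk ⟨hm.1, hm.2.trans ht.2⟩ ht hm.2.le
  · exact hR t ⟨hlt, ht.2⟩

/-- At a split point the tangent is directed downwards. -/
theorem IsSplitPoint.sin_τ_neg (h : γ.k₁ < γ.k₂) (hc : γ.IsNormalized c) {s : ℝ}
    (hs : γ.IsSplitPoint s) : Real.sin (γ.τ s) < 0 := by
  obtain ⟨hs, hl, hr⟩ := hs
  -- For `κ = 0` the circle is the tangent line: the end `c` is weakly on its left and the start
  -- `-c` weakly on its right. A horizontal tangent would make it touch both.
  have h1 := contact_nonpos h hs.1 hs.2 le_rfl hr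
  have h2 := contact_nonneg h le_rfl hs.1 hs.2 hl
  have h3 := not_contact_both h hs hl hr
  obtain ⟨hc0, hZ0, hZS⟩ := hc
  rw [hZS] at h1 h3
  rw [hZ0] at h2 h3
  simp only [contact, tangentDist, zero_mul, zero_sub, Complex.neg_re, Complex.neg_im,
    Complex.ofReal_re, Complex.ofReal_im, neg_zero] at h1 h2 h3
  have h4 : 2 * c * Real.sin (γ.τ s) ≤ 0 := by linarith
  have h5 : Real.sin (γ.τ s) ≤ 0 := by
    by_contra! h
    nlinarith
  refine lt_of_le_of_ne h5 fun h6 => ?_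
  rw [h6] at h1 h2 h3
  exact h3 (by linarith) (by linarith)

/-- The curve passes the left complement of the chord upwards. -/
theorem sin_τ_pos_of_mem_leftComplementPoints (h : γ.k₁ < γ.k₂) (hc : γ.IsNormalized c) {s : ℝ}
    (hs : s ∈ γ.leftComplementPoints c) : 0 < Real.sin (γ.τ s) := by
  obtain ⟨hs, him, hre⟩ := hs
  have hk := γ.monotoneOn_of_lt h
  have hl : ∀ t ∈ Ioo 0 s, γ.k t ≤ γ.k s := fun t ht => hk ⟨ht.1, ht.2.trans hs.2⟩ hs ht.2.le
  have hr : ∀ t ∈ Ioo s γ.S, γ.k s ≤ γ.k t := fun t ht => hk hs ⟨hs.1.trans ht.1, ht.2⟩ ht.1.le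
  have h1 := contact_nonpos h hs.1.le hs.2.le le_rfl hr
  have h2 := contact_nonneg h le_rfl hs.1.le hs.2.le hl
  have h3 := not_contact_both h (Ioo_subset_Icc_self hs) hl hr
  obtain ⟨hc0, hZ0, hZS⟩ := hc
  rw [hZS] at h1 h3
  rw [hZ0] at h2 h3
  simp only [contact, tangentDist, halfSqDist, Complex.neg_re, Complex.neg_im,
    Complex.ofReal_re, Complex.ofReal_im, neg_zero, him, sub_zero, zero_mul, zero_sub] at h1 h2 h3
  by_contra! hsin
  set x := (γ.Z s).re
  set σ := Real.sin (γ.τ s)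
  set κ := γ.k s
  have ha : 0 < -c - x := by linarith
  have hb : 0 < c - x := by linarith
  -- For a point of the axis at abscissa difference `d` from the curve point, the contact value is
  -- `d * (κ * d / 2 + σ)`; both chord ends have `d > 0`. If `σ ≤ 0`, the two signs leave only `κ =
  -- σ = 0`, a contact with both ends.
  have h1' : κ * (c - x) / 2 + σ ≤ 0 := by
    by_contra! hlt
    nlinarith [mul_pos hb hlt]
  have h2' : 0 ≤ κ * (-c - x) / 2 + σ := by
    by_contra! hlt
    nlinarith [mul_pos ha (neg_pos.2 hlt)]
  have hκ0 : κ = 0 := by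
    have h4 : κ * c ≤ 0 := by linarith
    have h5 : κ ≤ 0 := by
      by_contra! hlt
      nlinarith [mul_pos hlt hc0]
    have h6 : 0 ≤ κ * (-c - x) := by linarith
    refine le_antisymm h5 ?_
    by_contra! hlt
    nlinarith [mul_pos (neg_pos.2 hlt) ha]
  rw [hκ0] at h2' h3
  have hσ : σ = 0 := by linarith
  rw [hσ] at h3
  exact h3 (by ring) (by ring)

/-- A point with opposite tangent that precedes some points of negative curvature is followed by
an arc where the tangent angle is strictly decreasing. -/
theorem exists_k_neg_of_cos_eq (h : γ.k₁ < γ.k₂) (hc : γ.IsNormalized c) {s₀ s : ℝ}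
    (hs₀ : γ.IsSplitPoint s₀) (hs : 0 ≤ s) (hss : s ≤ s₀) (hcos : Real.cos (γ.τ s) = -1) :
    ∃ t ∈ Ioo s γ.S, γ.k t < 0 := by
  by_contra! hall
  -- Without negative curvature after `s`, the point `s` would itself be a split point, where the
  -- tangent is not horizontal.
  have : γ.IsSplitPoint s := ⟨⟨hs, hss.trans hs₀.1.2⟩,
    fun t ht => hs₀.2.1 t ⟨ht.1, ht.2.trans_le hss⟩, hall⟩
  have h1 := this.sin_τ_neg h hc
  have := Real.sin_sq_add_cos_sq (γ.τ s)
  rw [hcos] at this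
  nlinarith

theorem τ_lt_of_k_neg (h : γ.k₁ < γ.k₂) {a b t : ℝ} (ha : 0 ≤ a) (hab : a < b) (hbt : b ≤ t)
    (ht : t < γ.S) (hk : γ.k t < 0) : γ.τ b < γ.τ a := by
  have h1 := γ.τ_sub (a := a) (b := b) ⟨ha, by linarith⟩ ⟨by linarith, by linarith⟩
  have h2 : ∫ σ in a..b, γ.k σ ≤ ∫ _ in a..b, γ.k t := by
    refine intervalIntegral.integral_mono_on_of_le_Ioo hab.le
      (γ.intervalIntegrable_k ⟨ha, by linarith⟩ ⟨by linarith, by linarith⟩)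
      intervalIntegrable_const fun x hx => ?_
    exact γ.monotoneOn_of_lt h ⟨ha.trans_lt hx.1, by linarith [hx.2]⟩ ⟨by linarith, ht⟩
      (by linarith [hx.2])
  rw [intervalIntegral.integral_const, smul_eq_mul] at h2
  nlinarith [mul_pos (sub_pos.2 hab) (neg_pos.2 hk)]

end Spiral

theorem Real.sin_pos_of_cos_eq_neg_one {x y : ℝ} (hx : Real.cos x = -1) (hyx : y < x)
    (hxy : |y - x| < Real.pi) : 0 < Real.sin y := by
  have hs : Real.sin x = 0 := by
    have := Real.sin_sq_add_cos_sq x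
    rw [hx] at this
    nlinarith
  have h1 : Real.sin y = -Real.sin (y - x) := by
    rw [Real.sin_sub, hx, hs]; ring
  have h2 := Real.sin_neg_of_neg_of_neg_pi_lt (sub_neg.2 hyx) (by linarith [(abs_lt.1 hxy).1])
  linarith

/-! ### The cumulative chord angle and the left counters -/

namespace Spiral

variable {γ : Spiral} {c : ℝ} {μ : ℝ → ℝ → ℝ}

theorem im_lt_im {a b : ℝ} (ha : 0 ≤ a) (hab : a < b) (hb : b ≤ γ.S)
    (hsin : ∀ t ∈ Ioo a b, 0 < Real.sin (γ.τ t)) : (γ.Z a).im < (γ.Z b).im := by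
  refine strictMonoOn_of_deriv_pos (convex_Icc a b)
    (γ.continuousOn_im.mono (Icc_subset_Icc ha hb)) (fun t ht => ?_) ⟨le_rfl, hab.le⟩
    ⟨hab.le, le_rfl⟩ hab
  rw [interior_Icc] at ht
  have ht' : t ∈ Ioo 0 γ.S := ⟨ha.trans_lt ht.1, ht.2.trans_le hb⟩
  rw [((γ.hasDerivWithinAt_im (Ioo_subset_Icc_self ht')).hasDerivAt
    (Icc_mem_nhds ht'.1 ht'.2)).deriv]
  exact hsin t ht

namespace IsCumulativeChordAngle

theorem re_im (hμ : γ.IsCumulativeChordAngle μ) {u v : ℝ} (hu : 0 ≤ u) (huv : u < v)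
    (hv : v ≤ γ.S) : 0 < ‖γ.Z v - γ.Z u‖ ∧
      (γ.Z v).re - (γ.Z u).re = ‖γ.Z v - γ.Z u‖ * Real.cos (μ u v) ∧
      (γ.Z v).im - (γ.Z u).im = ‖γ.Z v - γ.Z u‖ * Real.sin (μ u v) := by
  obtain ⟨hne, h⟩ := hμ.2.2 u v hu huv hv
  refine ⟨norm_pos_iff.2 (sub_ne_zero.2 hne.symm), ?_, ?_⟩
  · have := congrArg Complex.re h
    rwa [Complex.re_ofReal_mul, Complex.exp_ofReal_mul_I_re, Complex.sub_re] at this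
  · have := congrArg Complex.im h
    rwa [Complex.im_ofReal_mul, Complex.exp_ofReal_mul_I_im, Complex.sub_im] at this

theorem continuousOn_left (hμ : γ.IsCumulativeChordAngle μ) :
    ContinuousOn (fun v => μ 0 v) (Icc 0 γ.S) :=
  hμ.1.comp (f := fun v => ((0 : ℝ), v)) (by fun_prop) fun v hv => ⟨le_rfl, hv.1, hv.2⟩

theorem leftComplementPoints_eq (hμ : γ.IsCumulativeChordAngle μ) (hc : γ.IsNormalized c) :
    γ.leftComplementPoints c = {s | s ∈ Ioo 0 γ.S ∧ Real.cos (μ 0 s) = -1} := by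
  ext s
  simp only [leftComplementPoints, mem_ofPred_eq, and_congr_right_iff]
  intro hs
  obtain ⟨hr, hre, him⟩ := hμ.re_im le_rfl hs.1 hs.2.le
  rw [hc.2.1] at hr hre him
  simp only [Complex.neg_re, Complex.neg_im, Complex.ofReal_re, Complex.ofReal_im, neg_zero,
    sub_zero, sub_neg_eq_add] at hr hre him
  have hsc := Real.sin_sq_add_cos_sq (μ 0 s)
  constructor
  · rintro ⟨h1, h2⟩
    rw [h1] at him
    have h3 : Real.sin (μ 0 s) = 0 := (mul_eq_zero.1 him.symm).resolve_left hr.ne'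
    have h4 : Real.cos (μ 0 s) < 0 := by
      by_contra! h
      have := mul_nonneg hr.le h
      linarith
    rw [h3] at hsc
    nlinarith
  · intro h
    rw [h] at hsc hre
    have h3 : Real.sin (μ 0 s) = 0 := by nlinarith
    rw [h3] at him
    exact ⟨by linarith, by linarith⟩

theorem exists_chord_eq (hμ : γ.IsCumulativeChordAngle μ) (hc : γ.IsNormalized c) :
    ∃ j : ℤ, μ 0 γ.S = 2 * Real.pi * j := by
  obtain ⟨hr, hre, him⟩ := hμ.re_im le_rfl γ.S_pos le_rfl
  obtain ⟨hc0, h0, hS⟩ := hc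
  rw [h0, hS] at hr hre him
  simp only [Complex.neg_re, Complex.neg_im, Complex.ofReal_re, Complex.ofReal_im, neg_zero,
    sub_zero, sub_neg_eq_add] at hr hre him
  have hsc := Real.sin_sq_add_cos_sq (μ 0 γ.S)
  have h3 : Real.sin (μ 0 γ.S) = 0 := (mul_eq_zero.1 him.symm).resolve_left hr.ne'
  have h4 : 0 < Real.cos (μ 0 γ.S) := by
    by_contra! h
    nlinarith
  have h5 : Real.cos (μ 0 γ.S) = 1 := by
    rw [h3] at hsc
    nlinarith
  obtain ⟨n, hn⟩ := (Real.cos_eq_one_iff _).1 h5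
  exact ⟨n, by rw [← hn]; ring⟩

/-- The chords that span a split point deviate from the tangent at this point to the left. -/
theorem chord_sub_τ_mem (hμ : γ.IsCumulativeChordAngle μ) (h : γ.k₁ < γ.k₂) {s₀ : ℝ}
    (hs₀ : γ.IsSplitPoint s₀) : μ 0 γ.S - γ.τ s₀ ∈ Icc 0 Real.pi := by
  obtain ⟨hs, hl, hr⟩ := hs₀
  -- A family of chords growing from the degenerate one at `s₀` to the whole chord. The tangent line
  -- at `s₀` separates the ends of each, so the sine of `f` stays nonnegative and `f`, starting at
  -- `0`, cannot leave `[0, π]`.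
  set f : ℝ → ℝ := fun t => μ (s₀ * (1 - t)) (s₀ + (γ.S - s₀) * t) - γ.τ s₀ with hf
  have hmem : ∀ t ∈ Icc (0 : ℝ) 1, 0 ≤ s₀ * (1 - t) ∧ s₀ * (1 - t) ≤ s₀ ∧
      s₀ ≤ s₀ + (γ.S - s₀) * t ∧ s₀ + (γ.S - s₀) * t ≤ γ.S := by
    intro t ht
    have h1 := mul_nonneg hs.1 ht.1
    have h2 := mul_nonneg hs.1 (sub_nonneg.2 ht.2)
    have h3 := mul_nonneg (sub_nonneg.2 hs.2) ht.1
    have h4 := mul_nonneg (sub_nonneg.2 hs.2) (sub_nonneg.2 ht.2)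
    exact ⟨h2, by linarith, by linarith, by linarith⟩
  have hcont : ContinuousOn f (Icc 0 1) := by
    refine ContinuousOn.sub (hμ.1.comp
      (f := fun t : ℝ => (s₀ * (1 - t), s₀ + (γ.S - s₀) * t)) (by fun_prop) fun t ht => ?_)
      continuousOn_const
    obtain ⟨h1, h2, h3, h4⟩ := hmem t ht
    exact ⟨h1, h2.trans h3, h4⟩
  have hsin : ∀ t ∈ Icc (0 : ℝ) 1, 0 ≤ Real.sin (f t) := by
    intro t ht
    obtain ⟨h1, h2, h3, h4⟩ := hmem t ht
    simp only [hf]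
    set u := s₀ * (1 - t)
    set v := s₀ + (γ.S - s₀) * t
    rcases (h2.trans h3).eq_or_lt with huv | huv
    · have hu : u = s₀ := by linarith
      have hv : v = s₀ := by linarith
      rw [hu, hv, hμ.2.1 s₀ hs]
      simp
    · obtain ⟨hρ, hre, him⟩ := hμ.re_im h1 huv h4
      have c1 := contact_nonpos h hs.1 h3 h4 hr
      have c2 := contact_nonneg h h1 h2 hs.2 hl
      simp only [contact, tangentDist, zero_mul, zero_sub] at c1 c2
      rw [Real.sin_sub]
      have : 0 ≤ ‖γ.Z v - γ.Z u‖ * (Real.sin (μ u v) * Real.cos (γ.τ s₀) -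
          Real.cos (μ u v) * Real.sin (γ.τ s₀)) := by
        have e : ‖γ.Z v - γ.Z u‖ * (Real.sin (μ u v) * Real.cos (γ.τ s₀) -
          Real.cos (μ u v) * Real.sin (γ.τ s₀)) = ((γ.Z v).im - (γ.Z u).im) * Real.cos (γ.τ s₀) -
            ((γ.Z v).re - (γ.Z u).re) * Real.sin (γ.τ s₀) := by
          rw [hre, him]; ring
        rw [e]
        linarith
      exact nonneg_of_mul_nonneg_right this hρ
  have hf0 : f 0 = 0 := by simp [hf, hμ.2.1 s₀ hs]
  have hf1 : f 1 = μ 0 γ.S - γ.τ s₀ := by simp [hf]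
  rw [← hf1]
  have hpi := Real.pi_pos
  constructor
  · by_contra! hlt
    -- The cut-off at `-π / 2` selects an attained value in `(-π, 0)`, however far `f 1` lies below;
    -- `3π / 2` plays the same role above `π`.
    obtain ⟨t, ht, hft⟩ := intermediate_value_Icc' zero_le_one hcont
      (show max (f 1) (-(Real.pi / 2)) ∈ Icc (f 1) (f 0) from
        ⟨le_max_left _ _, by rw [hf0]; exact max_le hlt.le (by linarith)⟩)
    have h1 := hsin t ht
    rw [hft] at h1
    exact absurd h1 (not_le.2 (Real.sin_neg_of_neg_of_neg_pi_lt
      (max_lt hlt (by linarith)) (lt_max_of_lt_right (by linarith))))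
  · by_contra! hlt
    obtain ⟨t, ht, hft⟩ := intermediate_value_Icc zero_le_one hcont
      (show min (f 1) (3 * Real.pi / 2) ∈ Icc (f 0) (f 1) from
        ⟨by rw [hf0]; exact le_min (by linarith) (by linarith), min_le_left _ _⟩)
    have h1 := hsin t ht
    rw [hft] at h1
    have h2 : Real.sin (min (f 1) (3 * Real.pi / 2) - Real.pi) ≤ 0 := by
      rw [Real.sin_sub_pi]; linarith
    refine absurd h2 (not_le.2 (Real.sin_pos_of_pos_of_lt_pi ?_ ?_))
    · exact sub_pos.2 (lt_min hlt (by linarith))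
    · have := min_le_right (f 1) (3 * Real.pi / 2)
      linarith

/-- The left half of the relation between the cumulative angles and the counters, for increasing
curvature. -/
theorem left_counters (hμ : γ.IsCumulativeChordAngle μ) (h : γ.k₁ < γ.k₂)
    (hc : γ.IsNormalized c) {s₀ : ℝ} (hs₀ : γ.IsSplitPoint s₀) {α : ℝ}
    (hα : α ∈ Ioc (-Real.pi) Real.pi) (hατ : (α : Real.Angle) = (γ.τ 0 : Real.Angle)) :
    (γ.leftOppositeTangents s₀).Finite ∧ (γ.leftComplementPoints c).Finite ∧
      (γ.leftOppositeTangents s₀).ncard = (γ.leftComplementPoints c).ncard ∧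
      γ.cumulativeAlpha μ = α + 2 * Real.pi * (γ.leftComplementPoints c).ncard := by
  have hpi := Real.pi_pos
  have hS := γ.S_pos
  obtain ⟨n, hn⟩ := Real.Angle.angle_eq_iff_two_pi_dvd_sub.1 hατ
  obtain ⟨j, hj⟩ := hμ.exists_chord_eq hc
  have hτ0 : γ.τ 0 ∈ Ioc (2 * Real.pi * (-n : ℤ) - Real.pi) (2 * Real.pi * (-n : ℤ) + Real.pi) := by
    push_cast
    exact ⟨by linarith [hα.1], by linarith [hα.2]⟩
  have hsin₀ := hs₀.sin_τ_neg h hc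
  -- The comparison with the chord gives `[2πj - π, 2πj]`; the nonzero sine excludes the lower end.
  have hτs : γ.τ s₀ ∈ Ioo (2 * Real.pi * j - Real.pi) (2 * Real.pi * j + Real.pi) := by
    have := hμ.chord_sub_τ_mem h hs₀
    rw [hj] at this
    refine ⟨lt_of_le_of_ne (by linarith [this.2]) fun hEq => ?_, by linarith [this.1]⟩
    rw [← hEq, show 2 * Real.pi * j - Real.pi = j * (2 * Real.pi) - Real.pi by ring,
      Real.sin_sub_pi, ← zero_add (j * (2 * Real.pi)), Real.sin_add_int_mul_two_pi] at hsin₀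
    simp at hsin₀
  have near : ∀ {g : ℝ → ℝ} {x : ℝ} {l : Filter ℝ}, Tendsto g l (𝓝 (g x)) →
      ∀ᶠ y in l, |g y - g x| < Real.pi := fun hg => by
    filter_upwards [Metric.tendsto_nhds.1 hg _ hpi] with y hy
    rwa [Real.dist_eq] at hy
  have hfilt : ∀ {x : ℝ}, x ∈ Ico 0 γ.S → 𝓝[>] x ≤ 𝓝[Icc 0 γ.S] x := fun hx =>
    nhdsWithin_le_of_mem (Icc_mem_nhdsGT_of_mem hx)
  have hfilt' : ∀ {x : ℝ}, x ∈ Ioc 0 γ.S → 𝓝[<] x ≤ 𝓝[Icc 0 γ.S] x := fun hx =>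
    nhdsWithin_le_of_mem (Icc_mem_nhdsLT_of_mem hx)
  -- the opposite tangents
  have hset : γ.leftOppositeTangents s₀ = {s | s ∈ Ioo 0 s₀ ∧ Real.cos (γ.τ s) = -1} := by
    ext s
    simp only [leftOppositeTangents, mem_ofPred_eq]
    constructor
    · rintro ⟨hs, hss, hcos⟩
      refine ⟨⟨hs.1, lt_of_le_of_ne hss ?_⟩, hcos⟩
      rintro rfl
      have := Real.sin_sq_add_cos_sq (γ.τ s)
      rw [hcos] at this
      nlinarith
    · rintro ⟨hs, hcos⟩
      exact ⟨⟨hs.1, hs.2.trans_le hs₀.1.2⟩, hs.2.le, hcos⟩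
  obtain ⟨hM, hM'⟩ := finite_and_ncard_of_forall_crossing (g := γ.τ) (m₀ := -n) (j := j) hs₀.1.1
    (γ.continuousOn_τ.mono (Icc_subset_Icc le_rfl hs₀.1.2))
    (fun x hx hcos => by
      obtain ⟨t, ht, htk⟩ := exists_k_neg_of_cos_eq h hc hs₀ hx.1 hx.2.le hcos
      filter_upwards [Ioo_mem_nhdsGT ht.1] with y hy
      exact τ_lt_of_k_neg h hx.1 hy.1 hy.2.le ht.2 htk)
    (fun x hx hcos => by
      obtain ⟨t, ht, htk⟩ := exists_k_neg_of_cos_eq h hc hs₀ hx.1.le hx.2.le hcos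
      filter_upwards [Ioo_mem_nhdsLT hx.1] with y hy
      exact τ_lt_of_k_neg h hy.1.le hy.2 ht.1.le ht.2 htk)
    hτ0 hτs
  rw [← hset] at hM hM'
  -- the intersections with the complement of the chord
  have hsub := hμ.leftComplementPoints_eq hc
  have hZ0 : (γ.Z 0).im = 0 := by rw [hc.2.1]; simp
  have hup : ∀ x ∈ Ioo 0 γ.S, Real.cos (μ 0 x) = -1 →
      (γ.Z x).im = 0 ∧ ∀ᶠ y in 𝓝 x, 0 < Real.sin (γ.τ y) := by
    intro x hx hcos
    have hmem : x ∈ γ.leftComplementPoints c := by rw [hsub]; exact ⟨hx, hcos⟩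
    have h1 := sin_τ_pos_of_mem_leftComplementPoints h hc hmem
    have h2 := (Real.continuous_sin.comp_continuousOn γ.continuousOn_τ).continuousAt
      (Icc_mem_nhds hx.1 hx.2)
    exact ⟨hmem.2.1, h2.eventually_const_lt h1⟩
  -- The indices `m₀ = -n` and `j` are those used for `τ`, so the two counts agree. Since the curve
  -- passes the left ray upwards, its direction seen from `Z 0` turns clockwise there.
  obtain ⟨hN, hN'⟩ := finite_and_ncard_of_forall_crossing (g := fun v => μ 0 v) (m₀ := -n) (j := j)
    hS.le hμ.continuousOn_left
    (fun x hx hcos => by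
      have hpos : ∀ᶠ y in 𝓝[>] x, 0 < (γ.Z y).im := by
        -- At the start the chord angle is the tangent angle. If it is opposite to the chord, the
        -- negative curvature that follows turns the tangent clockwise, and the curve rises above
        -- the axis.
        rcases hx.1.eq_or_lt with rfl | hx0
        · rw [hμ.2.1 0 ⟨le_rfl, hS.le⟩] at hcos
          obtain ⟨t, ht, htk⟩ := exists_k_neg_of_cos_eq h hc hs₀ le_rfl hs₀.1.1 hcos
          have hτ := near ((γ.continuousOn_τ 0 ⟨le_rfl, hS.le⟩).mono_left (hfilt hx))
          obtain ⟨ε, hε, hεs⟩ := mem_nhdsGT_iff_exists_Ioo_subset.1 hτ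
          filter_upwards [Ioo_mem_nhdsGT ht.1, Ioo_mem_nhdsGT hε] with y hy hyε
          rw [← hZ0]
          refine im_lt_im le_rfl hy.1 (hy.2.trans ht.2).le fun w hw => ?_
          exact Real.sin_pos_of_cos_eq_neg_one hcos
            (τ_lt_of_k_neg h le_rfl hw.1 (hw.2.trans hy.2).le ht.2 htk)
            (hεs ⟨hw.1, hw.2.trans hyε.2⟩)
        · obtain ⟨hx1, hx2⟩ := hup x ⟨hx0, hx.2⟩ hcos
          obtain ⟨ε, hε, hεs⟩ := mem_nhdsGT_iff_exists_Ioo_subset.1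
            (hx2.filter_mono (nhdsWithin_le_nhds (s := Ioi x)))
          filter_upwards [Ioo_mem_nhdsGT hε, Ioo_mem_nhdsGT hx.2] with y hy hyS
          rw [← hx1]
          exact im_lt_im hx.1 hy.1 hyS.2.le fun w hw => hεs ⟨hw.1, hw.2.trans hy.2⟩
      filter_upwards [hpos, near ((hμ.continuousOn_left x ⟨hx.1, hx.2.le⟩).mono_left (hfilt hx)),
        Ioo_mem_nhdsGT hx.2] with y hy hyn hyS
      obtain ⟨hr, -, him⟩ := hμ.re_im le_rfl (hx.1.trans_lt hyS.1) hyS.2.le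
      rw [hZ0, sub_zero] at him
      rw [him] at hy
      exact Real.lt_of_cos_eq_neg_one_of_sin_pos hcos (pos_of_mul_pos_right hy hr.le) hyn)
    (fun x hx hcos => by
      obtain ⟨hx1, hx2⟩ := hup x hx hcos
      obtain ⟨ε, hε, hεs⟩ := mem_nhdsLT_iff_exists_Ioo_subset.1
        (hx2.filter_mono (nhdsWithin_le_nhds (s := Iio x)))
      filter_upwards [near ((hμ.continuousOn_left x ⟨hx.1.le, hx.2.le⟩).mono_left
        (hfilt' ⟨hx.1, hx.2.le⟩)), Ioo_mem_nhdsLT hx.1, Ioo_mem_nhdsLT hε] with y hyn hy0 hy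
      have him' := im_lt_im hy0.1.le hy.2 hx.2.le fun w hw => hεs ⟨hy.1.trans hw.1, hw.2⟩
      rw [hx1] at him'
      obtain ⟨hr, -, him⟩ := hμ.re_im le_rfl hy0.1 (hy0.2.trans hx.2).le
      rw [hZ0, sub_zero] at him
      rw [him] at him'
      exact Real.lt_of_cos_eq_neg_one_of_sin_neg hcos (neg_of_mul_neg_right him' hr.le) hyn)
    (by rw [hμ.2.1 0 ⟨le_rfl, hS.le⟩]; exact hτ0)
    (by rw [hj]; exact ⟨by linarith, by linarith⟩)
  rw [← hsub] at hN hN'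
  refine ⟨hM, hN, by exact_mod_cast hM'.trans hN'.symm, ?_⟩
  have hN'' : ((γ.leftComplementPoints c).ncard : ℝ) = -n - j := by exact_mod_cast hN'
  rw [hN'', cumulativeAlpha, hj]
  linear_combination -hn

end IsCumulativeChordAngle

end Spiral

/-! ### Existence of the cumulative chord angle -/

namespace Spiral

variable {γ : Spiral}

/-- The integral is the difference quotient of `Z`, in a form that remains continuous on the
diagonal `u = v`. The global extension `θ` of `τ` makes it continuous on the whole plane. -/
theorem integral_exp_τ {u v : ℝ} (hu : 0 ≤ u) (huv : u ≤ v) (hv : v ≤ γ.S) {θ : ℝ → ℝ}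
    (hθ : ∀ s ∈ Icc u v, θ s = γ.τ s) (hθc : Continuous θ) :
    ((v - u : ℝ) : ℂ) * ∫ t in (0 : ℝ)..1, Complex.exp ((θ (u + t * (v - u)) : ℂ) * Complex.I) =
      γ.Z v - γ.Z u := by
  have h := intervalIntegral.smul_integral_comp_add_mul (a := 0) (b := 1)
    (fun s => Complex.exp ((θ s : ℂ) * Complex.I)) (v - u) u
  have hsub : Icc u v ⊆ Icc 0 γ.S := Icc_subset_Icc hu hv
  have hint := MeasureTheory.integral_eq_of_hasDerivAt_off_countable_of_le γ.Z
    (fun s => Complex.exp ((θ s : ℂ) * Complex.I)) huv countable_empty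
    (γ.continuousOn_Z.mono hsub) (fun x hx => by
      have hx' := Ioo_subset_Icc_self hx.1
      rw [hθ x hx']
      exact (γ.hasDeriv_Z x (hsub hx')).hasDerivAt
        (Icc_mem_nhds (hu.trans_lt hx.1.1) (hx.1.2.trans_le hv)))
    (Continuous.intervalIntegrable (by fun_prop) _ _)
  rw [mul_zero, add_zero, mul_one, add_sub_cancel, hint, Complex.real_smul] at h
  rw [← h]
  simp only [mul_comm]

/-- For increasing curvature, a cumulative direction of the chords exists. -/
theorem exists_isCumulativeChordAngle_of_lt (h : γ.k₁ < γ.k₂) :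
    ∃ μ, γ.IsCumulativeChordAngle μ := by
  have hS := γ.S_pos.le
  set θ : ℝ → ℝ := fun s => γ.τ (max 0 (min s γ.S)) with hθdef
  have hθc : Continuous θ := γ.continuousOn_τ.comp_continuous (by fun_prop)
    fun s => ⟨le_max_left _ _, max_le hS (min_le_right _ _)⟩
  have hθ : ∀ s ∈ Icc 0 γ.S, θ s = γ.τ s := fun s hs => by
    simp only [hθdef]
    rw [min_eq_left hs.2, max_eq_right hs.1]
  -- A retraction of the plane onto the triangle of subarcs, so that the lift through `exp` is taken
  -- over `ℝ × ℝ`.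
  set r : ℝ × ℝ → ℝ × ℝ :=
    fun p => (max 0 (min p.1 (max 0 (min p.2 γ.S))), max 0 (min p.2 γ.S)) with hrdef
  have hrc : Continuous r := by fun_prop
  have hr : ∀ p, r p ∈ γ.subarcs := fun p =>
    ⟨le_max_left _ _, max_le (le_max_left _ _) (min_le_right _ _), max_le hS (min_le_right _ _)⟩
  have hr' : ∀ p ∈ γ.subarcs, r p = p := by
    rintro ⟨u, v⟩ ⟨h1, h2, h3⟩
    simp only at h1 h2 h3
    simp only [hrdef]
    rw [min_eq_left h3, max_eq_right (h1.trans h2), min_eq_left h2, max_eq_right h1]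
  set q : ℝ × ℝ → ℂ :=
    fun p => ∫ t in (0 : ℝ)..1, Complex.exp ((θ (p.1 + t * (p.2 - p.1)) : ℂ) * Complex.I) with hq
  have hqc : Continuous q := by
    refine intervalIntegral.continuous_parametric_intervalIntegral_of_continuous' ?_ 0 1
    simp only [Function.uncurry_def]
    fun_prop
  have hqZ : ∀ u v, 0 ≤ u → u ≤ v → v ≤ γ.S →
      ((v - u : ℝ) : ℂ) * q (u, v) = γ.Z v - γ.Z u := fun u v hu huv hv =>
    integral_exp_τ hu huv hv (fun s hs => hθ s ⟨hu.trans hs.1, hs.2.trans hv⟩) hθc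
  have hqd : ∀ u ∈ Icc 0 γ.S, q (u, u) = Complex.exp ((γ.τ u : ℂ) * Complex.I) := by
    intro u hu
    simp [hq, hθ u hu]
  have hq0 : ∀ p ∈ γ.subarcs, q p ≠ 0 := by
    rintro ⟨u, v⟩ ⟨h1, h2, h3⟩ h0
    simp only at h1 h2 h3
    rcases h2.eq_or_lt with rfl | huv
    · rw [hqd u ⟨h1, h3⟩] at h0
      exact Complex.exp_ne_zero _ h0
    · have := hqZ u v h1 h2 h3
      rw [h0, mul_zero] at this
      exact Z_ne h h1 huv h3 (sub_eq_zero.1 this.symm).symm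
  obtain ⟨L, ⟨-, hL⟩, -⟩ := Complex.isCoveringMapOn_exp.existsUnique_continuousMap_lifts
    (⟨q ∘ r, hqc.comp hrc⟩ : C(ℝ × ℝ, ℂ)) (a₀ := (0, 0))
    (e₀ := Complex.log ((q ∘ r) (0, 0)))
    (Complex.exp_log (hq0 _ (hr _))) (fun p => hq0 _ (hr p))
  have hL : ∀ p ∈ γ.subarcs, Complex.exp (L p) = q p := fun p hp => by
    have := congrFun hL p
    simpa [hr' p hp] using this
  have hdiag : ∀ u ∈ Icc 0 γ.S, (u, u) ∈ γ.subarcs := fun u hu => ⟨hu.1, le_rfl, hu.2⟩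
  -- On the diagonal the lifted angle and `τ` differ by a continuous function with values in the
  -- discrete group of multiples of `2π`. It is a constant `n`, which is subtracted.
  obtain ⟨n, hn, hnu⟩ := isPreconnected_Icc.eqOn_const_of_mapsTo (S := Icc 0 γ.S)
    (T := (AddSubgroup.zmultiples (2 * Real.pi) : Set ℝ))
    (SetLike.isDiscrete_iff_discreteTopology.2 inferInstance)
    (f := fun u => (L (u, u)).im - γ.τ u)
    ((Continuous.continuousOn (by fun_prop)).sub γ.continuousOn_τ)
    (fun u hu => by
      have h1 := hL _ (hdiag u hu)
      rw [hqd u hu, Complex.exp_eq_exp_iff_exists_int] at h1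
      obtain ⟨m, hm⟩ := h1
      have := congrArg Complex.im hm
      simp at this
      exact ⟨m, by simp [this]⟩)
    ⟨0, zero_mem _⟩
  obtain ⟨m, hm⟩ := hn
  have hm : (m : ℝ) * (2 * Real.pi) = n := by simpa using hm
  refine ⟨fun u v => (L (u, v)).im - n, Continuous.continuousOn (by fun_prop),
    fun u hu => ?_, fun u v hu huv hv => ⟨Z_ne h hu huv hv, ?_⟩⟩
  · have := hnu hu
    simp only [Function.const_apply] at this
    linarith
  · have h1 := hqZ u v hu huv.le hv
    have h2 := hL (u, v) ⟨hu, huv.le, hv⟩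
    have h3 : Complex.exp ((((L (u, v)).im - n : ℝ) : ℂ) * Complex.I) =
        Complex.exp ((L (u, v)).im * Complex.I) := by
      rw [Complex.exp_eq_exp_iff_exists_int]
      refine ⟨-m, ?_⟩
      rw [← hm]
      push_cast
      ring
    have h4 : q (u, v) = (‖q (u, v)‖ : ℂ) * Complex.exp ((L (u, v)).im * Complex.I) := by
      rw [← h2, Complex.norm_exp, Complex.ofReal_exp, ← Complex.exp_add, Complex.re_add_im]
    rw [h3, ← h1, norm_mul, Complex.norm_real, Real.norm_of_nonneg (sub_nonneg.2 huv.le),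
      Complex.ofReal_mul, mul_assoc, ← h4]

/-! ### Transport of angles and counters by the symmetries -/

variable {c : ℝ} {μ : ℝ → ℝ → ℝ}

theorem IsCumulativeChordAngle.reverse (hμ : γ.IsCumulativeChordAngle μ) :
    γ.reverse.IsCumulativeChordAngle fun u v => μ (γ.S - v) (γ.S - u) := by
  refine ⟨hμ.1.comp (f := fun p : ℝ × ℝ => (γ.S - p.2, γ.S - p.1)) (by fun_prop)
    fun p hp => ⟨sub_nonneg.2 hp.2.2, by linarith [hp.2.1], by linarith [hp.1]⟩,
    fun u hu => hμ.2.1 (γ.S - u) ⟨sub_nonneg.2 hu.2, by linarith [hu.1]⟩,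
    fun u v hu huv hv => ?_⟩
  obtain ⟨h1, h2⟩ := hμ.2.2 (γ.S - v) (γ.S - u) (sub_nonneg.2 hv) (by linarith) (by linarith)
  have e : γ.reverse.Z v - γ.reverse.Z u = γ.Z (γ.S - u) - γ.Z (γ.S - v) := by
    change -γ.Z (γ.S - v) - -γ.Z (γ.S - u) = _
    ring
  exact ⟨fun h => h1 (neg_injective h).symm, by rw [e]; exact h2⟩

theorem IsCumulativeChordAngle.mirror (hμ : γ.IsCumulativeChordAngle μ) :
    γ.mirror.IsCumulativeChordAngle fun u v => -μ u v := by
  refine ⟨hμ.1.neg, fun u hu => congrArg Neg.neg (hμ.2.1 u hu), fun u v hu huv hv => ?_⟩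
  obtain ⟨h1, h2⟩ := hμ.2.2 u v hu huv hv
  have e : γ.mirror.Z v - γ.mirror.Z u = starRingEnd ℂ (γ.Z v - γ.Z u) :=
    (map_sub (starRingEnd ℂ) _ _).symm
  refine ⟨fun h => h1 ((starRingEnd ℂ).injective h), ?_⟩
  rw [e, Complex.norm_conj]
  conv_lhs => rw [h2]
  rw [map_mul, Complex.conj_ofReal, ← Complex.exp_conj]
  simp

theorem mirror_mirror (γ : Spiral) : γ.mirror.mirror = γ := by
  simp [Spiral.mirror]

theorem IsNormalized.reverse (hc : γ.IsNormalized c) : γ.reverse.IsNormalized c := by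
  refine ⟨hc.1, ?_, ?_⟩
  · change -γ.Z (γ.S - 0) = _
    rw [sub_zero, hc.2.2]
  · change -γ.Z (γ.S - γ.S) = _
    rw [sub_self, hc.2.1, neg_neg]

theorem IsNormalized.mirror (hc : γ.IsNormalized c) : γ.mirror.IsNormalized c := by
  refine ⟨hc.1, ?_, ?_⟩
  · change starRingEnd ℂ (γ.Z 0) = _
    simp [hc.2.1]
  · change starRingEnd ℂ (γ.Z γ.S) = _
    simp [hc.2.2]

theorem IsSplitPoint.reverse {s₀ : ℝ} (hs₀ : γ.IsSplitPoint s₀) :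
    γ.reverse.IsSplitPoint (γ.S - s₀) := by
  obtain ⟨hs, hl, hr⟩ := hs₀
  refine ⟨⟨sub_nonneg.2 hs.2, by change γ.S - s₀ ≤ γ.S; linarith [hs.1]⟩, fun t ht => ?_,
    fun t ht => ?_⟩
  · exact neg_nonpos.2 (hr _ ⟨by linarith [ht.2], by linarith [ht.1]⟩)
  · exact neg_nonneg.2 (hl _ ⟨sub_pos.2 ht.2, by linarith [ht.1]⟩)

theorem IsReferencePoint.mirror {s₀ : ℝ} (hs₀ : γ.IsReferencePoint s₀) :
    γ.mirror.IsReferencePoint s₀ := by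
  have neg_pos' : ∀ {x : EReal}, x < 0 → 0 < -x := fun hx => by
    rw [← EReal.neg_lt_neg_iff]; simpa using hx
  have neg_neg' : ∀ {x : EReal}, 0 < x → -x < 0 := fun hx => by
    rw [← EReal.neg_lt_neg_iff]; simpa using hx
  have neg_nonneg' : ∀ {x : EReal}, x ≤ 0 → 0 ≤ -x := fun hx => by
    rw [← EReal.neg_le_neg_iff]; simpa using hx
  have neg_nonpos' : ∀ {x : EReal}, 0 ≤ x → -x ≤ 0 := fun hx => by
    rw [← EReal.neg_le_neg_iff]; simpa using hx
  rcases hs₀ with ⟨hs, ⟨h1, h2, hl, hr⟩ | ⟨h1, h2, hl, hr⟩⟩ | ⟨h1 | h1, h0⟩ | ⟨h1 | h1, h0⟩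
  · exact Or.inl ⟨hs, Or.inr ⟨neg_pos' h1, neg_neg' h2, fun s h => neg_nonneg.2 (hl s h),
      fun s h => neg_nonpos.2 (hr s h)⟩⟩
  · exact Or.inl ⟨hs, Or.inl ⟨neg_neg' h1, neg_pos' h2, fun s h => neg_nonpos.2 (hl s h),
      fun s h => neg_nonneg.2 (hr s h)⟩⟩
  · exact Or.inr (Or.inl ⟨Or.inr ⟨EReal.neg_lt_neg_iff.2 h1.2, neg_nonpos' h1.1⟩, h0⟩)
  · exact Or.inr (Or.inl ⟨Or.inl ⟨neg_nonneg' h1.2, EReal.neg_lt_neg_iff.2 h1.1⟩, h0⟩)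
  · exact Or.inr (Or.inr ⟨Or.inr ⟨neg_nonneg' h1.2, EReal.neg_lt_neg_iff.2 h1.1⟩, h0⟩)
  · exact Or.inr (Or.inr ⟨Or.inl ⟨EReal.neg_lt_neg_iff.2 h1.2, neg_nonpos' h1.1⟩, h0⟩)

theorem reverse_leftOppositeTangents (γ : Spiral) (s₀ : ℝ) :
    γ.reverse.leftOppositeTangents (γ.S - s₀) =
      (fun s => γ.S - s) '' γ.rightOppositeTangents s₀ := by
  ext s
  constructor
  · rintro ⟨hs, hss, hcos⟩
    exact ⟨γ.S - s, ⟨⟨sub_pos.2 hs.2, by linarith [hs.1]⟩, by linarith, hcos⟩, by ring⟩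
  · rintro ⟨t, ⟨ht, htt, hcos⟩, rfl⟩
    refine ⟨⟨sub_pos.2 ht.2, by change γ.S - t < γ.S; linarith [ht.1]⟩, by linarith, ?_⟩
    change Real.cos (γ.τ (γ.S - (γ.S - t))) = -1
    rwa [sub_sub_cancel]

theorem reverse_leftComplementPoints (γ : Spiral) (c : ℝ) :
    γ.reverse.leftComplementPoints c = (fun s => γ.S - s) '' γ.rightComplementPoints c := by
  ext s
  constructor
  · rintro ⟨hs, him, hre⟩
    exact ⟨γ.S - s, ⟨⟨sub_pos.2 hs.2, by linarith [hs.1]⟩, neg_eq_zero.1 him,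
      neg_lt_neg_iff.1 hre⟩, by ring⟩
  · rintro ⟨t, ⟨ht, him, hre⟩, rfl⟩
    refine ⟨⟨sub_pos.2 ht.2, by change γ.S - t < γ.S; linarith [ht.1]⟩, ?_, ?_⟩
    · change (-γ.Z (γ.S - (γ.S - t))).im = 0
      rw [sub_sub_cancel, Complex.neg_im, him, neg_zero]
    · change (-γ.Z (γ.S - (γ.S - t))).re < -c
      rw [sub_sub_cancel, Complex.neg_re]
      linarith

/-- Reversal keeps the normalization and the angle of the whole chord, and exchanges the branches,
the two rays and the boundary angles. -/
theorem IsCumulativeChordAngle.right_counters (hμ : γ.IsCumulativeChordAngle μ)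
    (h : γ.k₁ < γ.k₂) (hc : γ.IsNormalized c) {s₀ : ℝ} (hs₀ : γ.IsSplitPoint s₀) {β : ℝ}
    (hβ : β ∈ Ioc (-Real.pi) Real.pi) (hβτ : (β : Real.Angle) = (γ.τ γ.S : Real.Angle)) :
    (γ.rightOppositeTangents s₀).Finite ∧ (γ.rightComplementPoints c).Finite ∧
      (γ.rightOppositeTangents s₀).ncard = (γ.rightComplementPoints c).ncard ∧
      γ.cumulativeBeta μ = β + 2 * Real.pi * (γ.rightComplementPoints c).ncard := by
  have hinj : Function.Injective fun s : ℝ => γ.S - s := sub_right_injective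
  have key := hμ.reverse.left_counters (γ.reverse_k₁_lt h) hc.reverse hs₀.reverse hβ
    (by rw [hβτ]; simp [Spiral.reverse])
  rw [reverse_leftOppositeTangents, reverse_leftComplementPoints,
    finite_image_iff hinj.injOn, finite_image_iff hinj.injOn, hinj.injOn.ncard_image,
    hinj.injOn.ncard_image] at key
  refine ⟨key.1, key.2.1, key.2.2.1, ?_⟩
  rw [← key.2.2.2]
  simp [cumulativeAlpha, cumulativeBeta, Spiral.reverse]

theorem neg_of_sin_neg {α : ℝ} (hα : α ∈ Ioc (-Real.pi) Real.pi) (hsin : Real.sin α < 0) :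
    α < 0 := by
  by_contra! h
  exact absurd hsin (not_lt.2 (Real.sin_nonneg_of_nonneg_of_le_pi h hα.2))

theorem IsReferencePoint.eq_zero {s₀ : ℝ} (hs₀ : γ.IsReferencePoint s₀) (h : γ.k₁ < γ.k₂)
    (h0 : 0 ≤ γ.k₁) : s₀ = 0 := by
  rcases hs₀ with ⟨-, ⟨h1, -⟩ | ⟨h1, h2, -⟩⟩ | ⟨-, hs⟩ | ⟨h1 | h1, -⟩
  · exact absurd h1 (not_lt.2 h0)
  · exact absurd (h.trans (h2.trans h1)) (lt_irrefl _)
  · exact hs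
  · exact absurd (h1.1.trans_le (h1.2.trans h0)) (lt_irrefl _)
  · exact absurd (h.trans h1.2) (lt_irrefl _)

theorem IsReferencePoint.eq_S {s₀ : ℝ} (hs₀ : γ.IsReferencePoint s₀) (h : γ.k₁ < γ.k₂)
    (h0 : γ.k₂ ≤ 0) : s₀ = γ.S := by
  rcases hs₀ with ⟨-, ⟨-, h1, -⟩ | ⟨h1, h2, -⟩⟩ | ⟨h1 | h1, -⟩ | ⟨-, hs⟩
  · exact absurd h1 (not_lt.2 h0)
  · exact absurd (h.trans (h2.trans h1)) (lt_irrefl _)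
  · exact absurd (h1.2.trans_le (h0.trans h1.1)) (lt_irrefl _)
  · exact absurd (h.trans h1.1) (lt_irrefl _)
  · exact hs

theorem mirror_leftOppositeTangents (γ : Spiral) (s₀ : ℝ) :
    γ.mirror.leftOppositeTangents s₀ = γ.leftOppositeTangents s₀ := by
  simp [leftOppositeTangents, Spiral.mirror]

theorem mirror_rightOppositeTangents (γ : Spiral) (s₀ : ℝ) :
    γ.mirror.rightOppositeTangents s₀ = γ.rightOppositeTangents s₀ := by
  simp [rightOppositeTangents, Spiral.mirror]

theorem mirror_leftComplementPoints (γ : Spiral) (c : ℝ) :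
    γ.mirror.leftComplementPoints c = γ.leftComplementPoints c := by
  simp [leftComplementPoints, Spiral.mirror]

theorem mirror_rightComplementPoints (γ : Spiral) (c : ℝ) :
    γ.mirror.rightComplementPoints c = γ.rightComplementPoints c := by
  simp [rightComplementPoints, Spiral.mirror]

/-- The counters of a normalized spiral with increasing curvature are finite and equal. -/
theorem counters_of_lt (h : γ.k₁ < γ.k₂) (hc : γ.IsNormalized c) {s₀ : ℝ}
    (hs₀ : γ.IsReferencePoint s₀) :
    (γ.leftOppositeTangents s₀).Finite ∧ (γ.rightOppositeTangents s₀).Finite ∧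
    (γ.leftComplementPoints c).Finite ∧ (γ.rightComplementPoints c).Finite ∧
    (γ.leftOppositeTangents s₀).ncard = (γ.leftComplementPoints c).ncard ∧
    (γ.rightOppositeTangents s₀).ncard = (γ.rightComplementPoints c).ncard := by
  -- The counters involve neither `μ` nor `α`, `β`; any cumulative angle and the principal values of
  -- `τ` at the ends serve.
  obtain ⟨μ, hμ⟩ := exists_isCumulativeChordAngle_of_lt h
  obtain ⟨l1, l2, l3, -⟩ := hμ.left_counters h hc (hs₀.isSplitPoint h)
    (Real.Angle.toReal_mem_Ioc (γ.τ 0 : Real.Angle)) (Real.Angle.coe_toReal _)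
  obtain ⟨r1, r2, r3, -⟩ := hμ.right_counters h hc (hs₀.isSplitPoint h)
    (Real.Angle.toReal_mem_Ioc (γ.τ γ.S : Real.Angle)) (Real.Angle.coe_toReal _)
  exact ⟨l1, r1, l2, r2, l3, r3⟩

end Spiral

/-! ### Assembly of the cases -/

theorem theorem5p9 (γ : Spiral) (c : ℝ) (hc : γ.IsNormalized c)
    (s₀ : ℝ) (hs₀ : γ.IsReferencePoint s₀)
    (M₁ M₂ N₁ N₂ : ℕ)
    (hM₁ : M₁ = (γ.leftOppositeTangents s₀).ncard)
    (hM₂ : M₂ = (γ.rightOppositeTangents s₀).ncard)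
    (hN₁ : N₁ = (γ.leftComplementPoints c).ncard)
    (hN₂ : N₂ = (γ.rightComplementPoints c).ncard) :
    -- the four counters count finite sets, and are pairwise equal
    (γ.leftOppositeTangents s₀).Finite ∧ (γ.rightOppositeTangents s₀).Finite ∧
    (γ.leftComplementPoints c).Finite ∧ (γ.rightComplementPoints c).Finite ∧
    M₁ = N₁ ∧ M₂ = N₂ ∧
    -- the cumulative angles exist
    (∃ μ, γ.IsCumulativeChordAngle μ) ∧
    -- and have the following values
    ∀ μ, γ.IsCumulativeChordAngle μ →
      -- increasing curvature
      (γ.k₁ < γ.k₂ → ∀ α ∈ Set.Ioc (-Real.pi) Real.pi, ∀ β ∈ Set.Ioc (-Real.pi) Real.pi,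
        (α : Real.Angle) = (γ.τ 0 : Real.Angle) → (β : Real.Angle) = (γ.τ γ.S : Real.Angle) →
          (γ.cumulativeAlpha μ = α + 2 * Real.pi * N₁ ∧
            γ.cumulativeBeta μ = β + 2 * Real.pi * N₂) ∧
          (0 ≤ γ.k₁ →
            (-Real.pi < α ∧ α < 0) ∧ (-Real.pi < β ∧ β ≤ Real.pi) ∧
            (γ.cumulativeAlpha μ = α ∧ N₁ = 0) ∧
            γ.cumulativeBeta μ = β + 2 * Real.pi * N₂) ∧
          (γ.k₁ < 0 → 0 < γ.k₂ →
            (-Real.pi < α ∧ α ≤ Real.pi) ∧ (-Real.pi < β ∧ β ≤ Real.pi) ∧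
            γ.cumulativeAlpha μ = α + 2 * Real.pi * N₁ ∧
            γ.cumulativeBeta μ = β + 2 * Real.pi * N₂) ∧
          (γ.k₂ ≤ 0 →
            (-Real.pi < α ∧ α ≤ Real.pi) ∧ (-Real.pi < β ∧ β < 0) ∧
            γ.cumulativeAlpha μ = α + 2 * Real.pi * N₁ ∧
            (γ.cumulativeBeta μ = β ∧ N₂ = 0))) ∧
      -- decreasing curvature
      (γ.k₂ < γ.k₁ → ∀ α ∈ Set.Ico (-Real.pi) Real.pi, ∀ β ∈ Set.Ico (-Real.pi) Real.pi,
        (α : Real.Angle) = (γ.τ 0 : Real.Angle) → (β : Real.Angle) = (γ.τ γ.S : Real.Angle) →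
          γ.cumulativeAlpha μ = α - 2 * Real.pi * N₁ ∧
          γ.cumulativeBeta μ = β - 2 * Real.pi * N₂) := by

  subst hM₁ hM₂ hN₁ hN₂
  have hcount : (γ.leftOppositeTangents s₀).Finite ∧ (γ.rightOppositeTangents s₀).Finite ∧
      (γ.leftComplementPoints c).Finite ∧ (γ.rightComplementPoints c).Finite ∧
      (γ.leftOppositeTangents s₀).ncard = (γ.leftComplementPoints c).ncard ∧
      (γ.rightOppositeTangents s₀).ncard = (γ.rightComplementPoints c).ncard := by
    rcases lt_or_gt_of_ne γ.k₁_ne_k₂ with h | h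
    · exact Spiral.counters_of_lt h hc hs₀
    · have := Spiral.counters_of_lt (γ := γ.mirror) (EReal.neg_lt_neg_iff.2 h) hc.mirror hs₀.mirror
      rwa [Spiral.mirror_leftOppositeTangents, Spiral.mirror_rightOppositeTangents,
        Spiral.mirror_leftComplementPoints, Spiral.mirror_rightComplementPoints] at this
  have hex : ∃ μ, γ.IsCumulativeChordAngle μ := by
    rcases lt_or_gt_of_ne γ.k₁_ne_k₂ with h | h
    · exact Spiral.exists_isCumulativeChordAngle_of_lt h
    · obtain ⟨μ, hμ⟩ := Spiral.exists_isCumulativeChordAngle_of_lt (γ := γ.mirror)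
        (EReal.neg_lt_neg_iff.2 h)
      have := hμ.mirror
      rw [Spiral.mirror_mirror] at this
      exact ⟨_, this⟩
  obtain ⟨f1, f2, f3, f4, e1, e2⟩ := hcount
  refine ⟨f1, f2, f3, f4, e1, e2, hex, fun μ hμ => ⟨fun h α hα β hβ hατ hβτ => ?_,
    fun h α hα β hβ hατ hβτ => ?_⟩⟩
  · have hsplit := hs₀.isSplitPoint h
    have hsin := hsplit.sin_τ_neg h hc
    obtain ⟨-, -, -, hl⟩ := hμ.left_counters h hc hsplit hα hατ
    obtain ⟨-, -, -, hr⟩ := hμ.right_counters h hc hsplit hβ hβτ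
    refine ⟨⟨hl, hr⟩, fun h0 => ?_, fun _ _ => ⟨hα, hβ, hl, hr⟩, fun h0 => ?_⟩
    · have hs := hs₀.eq_zero h h0
      have hN : (γ.leftComplementPoints c).ncard = 0 := by
        rw [← e1, ncard_eq_zero f1, eq_empty_iff_forall_notMem]
        rintro s ⟨hs1, hs2, -⟩
        linarith [hs1.1]
      rw [hs, ← Real.Angle.sin_coe, ← hατ, Real.Angle.sin_coe] at hsin
      refine ⟨⟨hα.1, Spiral.neg_of_sin_neg hα hsin⟩, hβ, ⟨?_, hN⟩, hr⟩
      rw [hl, hN]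
      simp
    · have hs := hs₀.eq_S h h0
      have hN : (γ.rightComplementPoints c).ncard = 0 := by
        rw [← e2, ncard_eq_zero f2, eq_empty_iff_forall_notMem]
        rintro s ⟨hs1, hs2, -⟩
        linarith [hs1.2]
      rw [hs, ← Real.Angle.sin_coe, ← hβτ, Real.Angle.sin_coe] at hsin
      refine ⟨hα, ⟨hβ.1, Spiral.neg_of_sin_neg hβ hsin⟩, hl, ?_, hN⟩
      rw [hr, hN]
      simp
  · have h' : γ.mirror.k₁ < γ.mirror.k₂ := EReal.neg_lt_neg_iff.2 h
    have hsplit := hs₀.mirror.isSplitPoint h'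
    -- Reflection negates all angles and preserves the counters; `-α` lies in `(-π, π]` precisely
    -- because `α` lies in `[-π, π)`.
    obtain ⟨-, -, -, hl⟩ := hμ.mirror.left_counters h' hc.mirror hsplit (α := -α)
      ⟨neg_lt_neg hα.2, by linarith [hα.1]⟩
      (by rw [Real.Angle.coe_neg, hατ]; exact (Real.Angle.coe_neg _).symm)
    obtain ⟨-, -, -, hr⟩ := hμ.mirror.right_counters h' hc.mirror hsplit (β := -β)
      ⟨neg_lt_neg hβ.2, by linarith [hβ.1]⟩
      (by rw [Real.Angle.coe_neg, hβτ]; exact (Real.Angle.coe_neg _).symm)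
    rw [Spiral.mirror_leftComplementPoints] at hl
    rw [Spiral.mirror_rightComplementPoints] at hr
    simp only [Spiral.cumulativeAlpha, Spiral.cumulativeBeta, Spiral.mirror] at hl hr
    simp only [Spiral.cumulativeAlpha, Spiral.cumulativeBeta]
    constructor <;> linarith
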